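/- Let $\operatorname{PreLie}$ be the symmetric operad over $\mathbb{Q}$ whose operations with inputs labelled by a finite set $I$ are the rational linear combinations of rooted trees with vertex set $I$; the composition of trees $\gamma(T;(S_i)_{i\in I})$ is obtained by replacing each vertex $i$ of $T$ by the tree $S_i$ and summing over all ways of grafting back the incoming edges of $i$ on vertices of $S_i$. The trees in which some vertex is neither the root nor attached to the root (the trees that are not corollas) span an operadic ideal; let $\psi:\operatorname{PreLie}\to\operatorname{Mu}$ be the quotient map to the quotient operad. For an operad $\mathcal{P}$ with $\mathcal{P}(0)=0$ and $\mathcal{P}(1)=\mathbb{Q}e$, let $\widehat{\mathcal{P}}=\prod_n\mathcal{P}(n)_{\mathfrak{S}_n}$ be the product of the coinvariants, with the associative product $$x\times y=\sum_{m\ge1}\ \sum_{n_1,\dots,n_m\ge1}\langle\gamma(\bar x_m,\bar y_{n_1},\dots,\bar y_{n_m})\rangle ,$$ where bars denote representatives and $\langle\,\rangle$ the class in the coinvariants, and let $\mathsf{G}_{\mathcal{P}}$ be the group of invertible elements of $(\widehat{\mathcal{P}},\times)$; $\psi$ induces a group morphism $\psi:\mathsf{G}_{\operatorname{PreLie}}\to\mathsf{G}_{\operatorname{Mu}}$.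 Identify $\widehat{\operatorname{PreLie}}$ with the completed free pre-Lie algebra on the generator $v$ (the one-vertex tree), the pre-Lie product $a\leftarrow b$ of two trees being the sum of all graftings of the root of $b$ on a vertex of $a$, and let $$\exp^*=\sum_{k\ge1}\frac{1}{k!}\,\underbrace{((\cdots(v\leftarrow v)\leftarrow\cdots)\leftarrow v)}_{k\text{ factors}} .$$ Let $\mathbb{Q}^*\ltimes(1+x\mathbb{Q}[[x]])$ be the group of pairs $(\lambda,f)$, with $\lambda\in\mathbb{Q}^*$ and $f\in 1+x\mathbb{Q}[[x]]$, with the product $(\lambda,f(x))(\theta,g(x))=(\lambda\theta,f(\theta x)g(x))$, and let $\nu_n\in\operatorname{Mu}(n+1)_{\mathfrak{S}_{n+1}}$ be the class of the corolla with $n+1$ vertices. Then there is a group isomorphism $\mathsf{G}_{\operatorname{Mu}}\cong\mathbb{Q}^*\ltimes(1+x\mathbb{Q}[[x]])$ sending $\lambda\sum_{n\ge0}f_n\nu_n$ (with $f_0=1$) to $(\lambda,\sum_n f_nx^n)$; the element $\exp^*$ belongs to $\mathsf{G}_{\operatorname{PreLie}}$; and, denoting its inverse in this group by $\log^*$, under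 this isomorphism $$\psi(\exp^*)=\Bigl(1,\frac{\exp x-1}{x}\Bigr),\qquad \psi(\log^*)=\Bigl(1,\frac{x}{\exp x-1}\Bigr).$$ Moreover, in the basis of (unlabelled) rooted trees, the coefficient of the corolla with $n$ vertices is $\frac{1}{n!}$ in $\exp^*$ and $\frac{B_{n-1}}{(n-1)!}$ in $\log^*$, for all $n\ge1$, where $B_k$ are the Bernoulli numbers, $\sum_k B_k\frac{x^k}{k!}=\frac{x}{\exp x-1}$ (so $B_1=-\frac12$). -/

import Mathlib

open scoped BigOperators PowerSeries

/-! ## Symmetric operads over `ℚ` -/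

/-- A symmetric operad in rational vector spaces, in the coordinate-free form in which the inputs
of an operation are labelled by a finite set `I` rather than by `1, …, n` (infinite label types
play no role). The classical component
`P(n)` is `obj (Fin n)`, with its action of the symmetric group given by `map`, and the classical
composition `γ(x; y₁, …, yₘ)` is `comp x y`, whose inputs are labelled by the disjoint union
`Σ i, J i` of the label sets of the `yᵢ`. The last two fields say that the operad is augmented:
`P(0) = 0` and `P(1) = ℚ e`. -/
structure AugOperad where
  obj : Type → Type
  [addCommGroup : ∀ I, AddCommGroup (obj I)]
  [module : ∀ I, Module ℚ (obj I)]
  /-- relabelling of the inputs -/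
  map : ∀ {I J : Type}, I ≃ J → obj I →ₗ[ℚ] obj J
  /-- the unit `e` -/
  one : obj Unit
  /-- the composition `γ` -/
  comp : ∀ {I : Type} [Finite I] {J : I → Type} [∀ i, Finite (J i)],
    obj I →ₗ[ℚ] MultilinearMap ℚ (fun i => obj (J i)) (obj (Σ i, J i))
  map_refl : ∀ {I : Type} (x : obj I), map (Equiv.refl I) x = x
  map_trans : ∀ {I J K : Type} (e : I ≃ J) (f : J ≃ K) (x : obj I),
    map (e.trans f) x = map f (map e x)
  /-- equivariance in the outer operation -/
  comp_map_left : ∀ {I I' : Type} [Finite I] [Finite I'] {J : I' → Type} [∀ i, Finite (J i)]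
    (e : I ≃ I') (x : obj I) (y : ∀ i, obj (J i)),
    comp (map e x) y = map (Equiv.sigmaCongrLeft e) (comp x fun i => y (e i))
  /-- equivariance in the inner operations -/
  comp_map_right : ∀ {I : Type} [Finite I] {J J' : I → Type} [∀ i, Finite (J i)]
    [∀ i, Finite (J' i)] (e : ∀ i, J i ≃ J' i) (x : obj I) (y : ∀ i, obj (J i)),
    comp x (fun i => map (e i) (y i)) = map (Equiv.sigmaCongrRight e) (comp x y)
  one_comp : ∀ {J : Type} [Finite J] (y : obj J),
    map (Equiv.uniqueSigma fun _ : Unit => J) (comp one fun _ => y) = y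
  comp_one : ∀ {I : Type} [Finite I] (x : obj I),
    map (Equiv.sigmaUnique I fun _ => Unit) (comp x fun _ => one) = x
  comp_assoc : ∀ {I : Type} [Finite I] {J : I → Type} [∀ i, Finite (J i)]
    {K : ∀ i, J i → Type} [∀ i j, Finite (K i j)]
    (x : obj I) (y : ∀ i, obj (J i)) (z : ∀ i j, obj (K i j)),
    map (Equiv.sigmaAssoc K) (comp (comp x y) fun p : Σ i, J i => z p.1 p.2) =
      comp x fun i => comp (y i) (z i)
  arity_zero : ∀ x : obj Empty, x = 0
  arity_one : ∀ x : obj Unit, ∃! c : ℚ, x = c • one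

namespace AugOperad

attribute [instance] AugOperad.addCommGroup AugOperad.module

section completion

variable (P : AugOperad)

/-- The action of the symmetric group on `P(n)`. -/
def rep (n : ℕ) : Representation ℚ (Equiv.Perm (Fin n)) (P.obj (Fin n)) where
  toFun σ := P.map σ
  map_one' := by ext x; exact P.map_refl x
  map_mul' σ τ := by ext x; exact P.map_trans τ σ x

/-- The space of coinvariants of `P(n)` under the symmetric group. -/
abbrev Coinv (n : ℕ) : Type := (P.rep n).Coinvariants

/-- The quotient map `⟨ ⟩` to the coinvariants in arity `n`. For a finite label set `I` with `n`
elements, an operation with inputs labelled by `I` is first relabelled by `Fin n` (the choice of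
the bijection does not matter); operations of any other arity have component `0` in arity `n`. -/
noncomputable def cls (n : ℕ) {I : Type} [Finite I] : P.obj I →ₗ[ℚ] P.Coinv n :=
  open Classical in
  if h : Nat.card I = n then
    Representation.Coinvariants.mk (P.rep n) ∘ₗ P.map (Finite.equivFinOfCardEq h)
  else 0

/-- The completion `∏ₙ P(n)_{𝔖ₙ}`. -/
def Completion : Type := ∀ n : ℕ, P.Coinv n

noncomputable instance : AddCommGroup P.Completion :=
  inferInstanceAs (AddCommGroup (∀ n : ℕ, P.Coinv n))

noncomputable instance : Module ℚ P.Completion :=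
  inferInstanceAs (Module ℚ (∀ n : ℕ, P.Coinv n))

variable {P}

/-- A representative in `P(n)` of a class of coinvariants. -/
noncomputable def Completion.lift (x : P.Completion) (n : ℕ) : P.obj (Fin n) :=
  Function.surjInv (Representation.Coinvariants.mk_surjective (P.rep n)) (x n)

lemma Completion.mk_lift (x : P.Completion) (n : ℕ) :
    Representation.Coinvariants.mk (P.rep n) (x.lift n) = x n :=
  Function.surjInv_eq _ _

/-- The product `x × y = ∑ₘ ∑_{n₁, …, nₘ ≥ 1} ⟨γ(xₘ; y_{n₁}, …, y_{nₘ})⟩`, component by component: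
only terms with `m ≤ n` and all `nᵢ ≤ n` contribute to the component of arity `n`. -/
noncomputable instance : Mul P.Completion where
  mul x y := fun n => ∑ m ∈ Finset.Icc 1 n,
    ∑ k ∈ Fintype.piFinset fun _ : Fin m => Finset.Icc 1 n,
      P.cls n (P.comp (x.lift m) fun i => y.lift (k i))

/-- The class of the unit `e` of the operad, placed in arity `1`. -/
noncomputable instance : One P.Completion where
  one := fun n => P.cls n P.one

lemma mul_apply (x y : P.Completion) (n : ℕ) :
    (x * y) n = ∑ m ∈ Finset.Icc 1 n,
      ∑ k ∈ Fintype.piFinset fun _ : Fin m => Finset.Icc 1 n,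
        P.cls n (P.comp (x.lift m) fun i => y.lift (k i)) := rfl

lemma one_apply (n : ℕ) : (1 : P.Completion) n = P.cls n P.one := rfl

lemma cls_of_ne {n : ℕ} {I : Type} [Finite I] (h : Nat.card I ≠ n) (x : P.obj I) :
    P.cls n x = 0 := by
  simp [cls, h]

lemma cls_fin (n : ℕ) (x : P.obj (Fin n)) :
    P.cls n x = Representation.Coinvariants.mk (P.rep n) x := by
  have h : Nat.card (Fin n) = n := by simp
  rw [cls, dif_pos h]
  exact Representation.Coinvariants.mk_self_apply (P.rep n) (Finite.equivFinOfCardEq h) x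

lemma cls_map (n : ℕ) {I J : Type} [Finite I] [Finite J] (e : I ≃ J) (x : P.obj I) :
    P.cls n (P.map e x) = P.cls n x := by
  by_cases h : Nat.card I = n
  · have h' : Nat.card J = n := by rw [← Nat.card_congr e, h]
    rw [cls, cls, dif_pos h, dif_pos h']
    simp only [LinearMap.comp_apply]
    rw [← P.map_trans]
    have : e.trans (Finite.equivFinOfCardEq h') = (Finite.equivFinOfCardEq h).trans
        (((Finite.equivFinOfCardEq h).symm.trans e).trans (Finite.equivFinOfCardEq h')) := by
      ext; simp
    rw [this, P.map_trans]
    exact Representation.Coinvariants.mk_self_apply (P.rep n) _ _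
  · have h' : Nat.card J ≠ n := by rwa [← Nat.card_congr e]
    rw [cls_of_ne h, cls_of_ne h']

/-- A linear map on operations that is invariant under relabelling only depends on the class. -/
lemma eq_of_mk_eq {n : ℕ} {W : Type} [AddCommGroup W] [Module ℚ W]
    (f : P.obj (Fin n) →ₗ[ℚ] W) (hf : ∀ (σ : Equiv.Perm (Fin n)) x, f (P.map σ x) = f x)
    {a b : P.obj (Fin n)}
    (h : Representation.Coinvariants.mk (P.rep n) a = Representation.Coinvariants.mk (P.rep n) b) :
    f a = f b := by
  have h0 := congrArg (Representation.Coinvariants.lift (P.rep n) f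
    (fun σ => LinearMap.ext (hf σ))) h
  simpa using h0

lemma lift_cls_eq {n : ℕ} {W : Type} [AddCommGroup W] [Module ℚ W]
    (f : P.obj (Fin n) →ₗ[ℚ] W) (hf : ∀ (σ : Equiv.Perm (Fin n)) x, f (P.map σ x) = f x)
    (x : P.Completion) (a : P.obj (Fin n)) (h : x n = Representation.Coinvariants.mk (P.rep n) a) :
    f (x.lift n) = f a :=
  eq_of_mk_eq f hf (by rw [Completion.mk_lift, h])

/-- The class of a composite only depends on the classes of the inner operations. -/
lemma cls_comp_congr (n : ℕ) {I : Type} [Finite I] (k : I → ℕ) (x : P.obj I)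
    (a b : ∀ i, P.obj (Fin (k i)))
    (h : ∀ i, Representation.Coinvariants.mk (P.rep (k i)) (a i) =
      Representation.Coinvariants.mk (P.rep (k i)) (b i)) :
    P.cls n (P.comp x a) = P.cls n (P.comp x b) := by
  classical
  have := Fintype.ofFinite I
  have key : ∀ s : Finset I,
      P.cls n (P.comp x (fun i => if i ∈ s then a i else b i)) = P.cls n (P.comp x b) := by
    intro s
    induction s using Finset.induction with
    | empty => simp
    | insert i s hi ih =>
      rw [← ih]
      set c : ∀ i, P.obj (Fin (k i)) := fun i => if i ∈ s then a i else b i with hc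
      have h1 : (fun j => if j ∈ insert i s then a j else b j) = Function.update c i (a i) := by
        ext j
        by_cases hj : j = i
        · subst hj; simp
        · simp [hj, hc]
      have h2 : c = Function.update c i (b i) := by
        ext j
        by_cases hj : j = i
        · subst hj; simp [hc, hi]
        · simp [hj]
      rw [h1]
      conv_rhs => rw [h2]
      refine eq_of_mk_eq (P.cls n ∘ₗ (P.comp x).toLinearMap c i) ?_ (h i)
      intro σ z
      simp only [LinearMap.comp_apply, MultilinearMap.toLinearMap_apply]
      have h3 : Function.update c i (P.map σ z) = fun j =>
          P.map (Function.update (fun j => Equiv.refl (Fin (k j))) i σ j)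
            (Function.update c i z j) := by
        ext j
        by_cases hj : j = i
        · subst hj; simp
        · simp [hj, P.map_refl]
      rw [h3, P.comp_map_right, cls_map]
  have := key Finset.univ
  simpa using this

/-- The total contribution in arity `n` of composites `γ(w; y_{k₁}, …)` with `1 ≤ kᵢ ≤ N`. -/
noncomputable def contrib (y : P.Completion) (N n : ℕ) {I : Type} [Fintype I] [DecidableEq I] :
    P.obj I →ₗ[ℚ] P.Coinv n where
  toFun w := ∑ k ∈ Fintype.piFinset fun _ : I => Finset.Icc 1 N,
    P.cls n (P.comp w fun i => y.lift (k i))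
  map_add' := by intro a b; simp [Finset.sum_add_distrib]
  map_smul' := by intro a b; simp [Finset.smul_sum]

lemma contrib_apply (y : P.Completion) (N n : ℕ) {I : Type} [Fintype I] [DecidableEq I]
    (w : P.obj I) : contrib y N n w = ∑ k ∈ Fintype.piFinset fun _ : I => Finset.Icc 1 N,
    P.cls n (P.comp w fun i => y.lift (k i)) := rfl

lemma contrib_map (y : P.Completion) (N n : ℕ) {I I' : Type} [Fintype I] [DecidableEq I]
    [Fintype I'] [DecidableEq I'] (e : I ≃ I') (w : P.obj I) :
    contrib y N n (P.map e w) = contrib y N n w := by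
  rw [contrib_apply, contrib_apply]
  refine Finset.sum_bij' (fun k _ => fun i => k (e i)) (fun k _ => fun i => k (e.symm i))
    ?_ ?_ ?_ ?_ ?_
  · intro k hk; simp only [Fintype.mem_piFinset] at hk ⊢; intro i; exact hk _
  · intro k hk; simp only [Fintype.mem_piFinset] at hk ⊢; intro i; exact hk _
  · intro k hk; simp
  · intro k hk; simp
  · intro k hk
    rw [P.comp_map_left, cls_map]

lemma contrib_eq_zero (y : P.Completion) (N n : ℕ) {I : Type} [Fintype I] [DecidableEq I]
    (w : P.obj I) (h : n < Fintype.card I) : contrib y N n w = 0 := by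
  rw [contrib_apply]
  refine Finset.sum_eq_zero fun k hk => cls_of_ne ?_ _
  simp only [Fintype.mem_piFinset, Finset.mem_Icc] at hk
  have h2 : ∑ i : I, 1 ≤ ∑ i, k i := Finset.sum_le_sum fun i _ => (hk i).1
  simp at h2 ⊢
  omega

lemma contrib_trunc (y : P.Completion) (N n : ℕ) (hN : n ≤ N) {I : Type} [Fintype I]
    [DecidableEq I] (w : P.obj I) : contrib y N n w = contrib y n n w := by
  rw [contrib_apply, contrib_apply]
  symm
  refine Finset.sum_subset ?_ ?_
  · exact Fintype.piFinset_subset _ _ fun _ => Finset.Icc_subset_Icc le_rfl hN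
  · intro k hk hk'
    refine cls_of_ne ?_ _
    simp only [Fintype.mem_piFinset, Finset.mem_Icc, not_forall] at hk hk'
    obtain ⟨i, hi⟩ := hk'
    have := Finset.single_le_sum (f := k) (fun _ _ => Nat.zero_le _) (Finset.mem_univ i)
    have := (hk i).1
    simp
    omega

/-- The product computed with any large enough truncation. -/
lemma mul_apply_trunc (x y : P.Completion) (N n : ℕ) (hN : n ≤ N) :
    (x * y) n = ∑ m ∈ Finset.Icc 1 N, contrib y N n (x.lift m) := by
  have h1 : (x * y) n = ∑ m ∈ Finset.Icc 1 n, contrib y N n (x.lift m) := by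
    rw [mul_apply]
    refine Finset.sum_congr rfl fun m _ => ?_
    rw [contrib_trunc y N n hN]; rfl
  rw [h1]
  refine Finset.sum_subset (Finset.Icc_subset_Icc le_rfl hN) fun m hm hm' => ?_
  apply contrib_eq_zero
  simp at hm hm' ⊢
  omega

/-- Any family of representatives computes the left factor of a product. -/
lemma contrib_lift (x y : P.Completion) (N n m : ℕ) (a : P.obj (Fin m))
    (h : x m = Representation.Coinvariants.mk (P.rep m) a) :
    contrib y N n (x.lift m) = contrib y N n a :=
  lift_cls_eq (contrib y N n) (fun σ w => contrib_map y N n σ w) x a h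

/-- The representative of `cls` used in computing products. -/
lemma contrib_of_cls (y : P.Completion) (N n m : ℕ) {I : Type} [Fintype I] [DecidableEq I]
    (w : P.obj I) (a : P.obj (Fin m))
    (h : Representation.Coinvariants.mk (P.rep m) a = P.cls m w) :
    contrib y N n a = if Fintype.card I = m then contrib y N n w else 0 := by
  by_cases hm : Nat.card I = m
  · rw [if_pos (by simpa using hm)]
    rw [cls, dif_pos hm] at h
    rw [eq_of_mk_eq (contrib y N n) (fun σ w => contrib_map y N n σ w) h, contrib_map]
  · rw [if_neg (by simpa using hm)]
    rw [cls_of_ne hm] at h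
    rw [eq_of_mk_eq (b := 0) (contrib y N n) (fun σ w => contrib_map y N n σ w) (by simpa using h)]
    simp

/-- a chosen representative of `cls m w` -/
noncomputable def clsRep (m : ℕ) {I : Type} [Finite I] (w : P.obj I) : P.obj (Fin m) :=
  open Classical in if h : Nat.card I = m then P.map (Finite.equivFinOfCardEq h) w else 0

lemma mk_clsRep (m : ℕ) {I : Type} [Finite I] (w : P.obj I) :
    Representation.Coinvariants.mk (P.rep m) (clsRep m w) = P.cls m w := by
  by_cases h : Nat.card I = m <;> simp [cls, clsRep, h]

protected lemma mul_one' (x : P.Completion) : x * 1 = x := by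
  funext n
  rw [mul_apply]
  by_cases hn : n = 0
  · subst hn
    simp only [Finset.Icc_eq_empty_of_lt Nat.zero_lt_one, Finset.sum_empty]
    have hs : x.lift 0 = 0 := by
      have h0 := P.arity_zero (P.map (Equiv.equivOfIsEmpty (Fin 0) Empty) (x.lift 0))
      have h1 := P.map_trans (Equiv.equivOfIsEmpty (Fin 0) Empty)
        (Equiv.equivOfIsEmpty Empty (Fin 0)) (x.lift 0)
      rw [h0, map_zero] at h1
      rw [← P.map_refl (x.lift 0), ← h1]
      congr 1
      congr 1
      exact Subsingleton.elim _ _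
    rw [← x.mk_lift 0, hs, map_zero]
  have hlift : ∀ (m : ℕ) (k : Fin m → ℕ) (w : P.obj (Fin m)), (¬ ∀ i, k i = 1) →
      P.cls n (P.comp w fun i => (1 : P.Completion).lift (k i)) = 0 := by
    intro m k w hk
    push Not at hk
    obtain ⟨i, hi⟩ := hk
    rw [cls_comp_congr (b := fun j => clsRep (k j) P.one)]
    · rw [(P.comp w).map_coord_zero i, map_zero]
      simp [clsRep, Ne.symm hi]
    · intro j
      rw [Completion.mk_lift, mk_clsRep, one_apply]
  have hone : ∀ (m : ℕ) (w : P.obj (Fin m)),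
      P.cls n (P.comp w fun i => (1 : P.Completion).lift 1) = P.cls n w := by
    intro m w
    have hc : Nat.card Unit = 1 := by simp
    rw [cls_comp_congr (k := fun _ => 1) (b := fun j => clsRep 1 P.one)]
    · conv_rhs => rw [← P.comp_one w, cls_map]
      have : (fun j : Fin m => clsRep 1 P.one) =
          fun j => P.map (Finite.equivFinOfCardEq hc) P.one := by
        funext j; simp [clsRep]
      rw [this, P.comp_map_right, cls_map]
    · intro j
      rw [Completion.mk_lift, mk_clsRep, one_apply]
  have hin : ∀ m, (∑ k ∈ Fintype.piFinset fun _ : Fin m => Finset.Icc 1 n,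
      P.cls n (P.comp (x.lift m) fun i => (1 : P.Completion).lift (k i))) =
      P.cls n (x.lift m) := by
    intro m
    rw [Finset.sum_eq_single (fun _ => 1)]
    · exact hone m _
    · intro k _ hk
      apply hlift
      intro h; exact hk (funext h)
    · intro h
      exfalso; apply h
      simp only [Fintype.mem_piFinset, Finset.mem_Icc]
      intro; omega
  simp_rw [hin]
  rw [Finset.sum_eq_single n]
  · rw [cls_fin, Completion.mk_lift]
  · intro m _ hm
    exact cls_of_ne (by simpa using hm) _
  · intro h; exfalso; apply h; simp; omega

protected lemma one_mul' (x : P.Completion) : 1 * x = x := by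
  funext n
  by_cases hn : n = 0
  · subst hn
    have h1 := congrFun (AugOperad.mul_one' x) 0
    rw [mul_apply] at h1 ⊢
    simpa using h1
  rw [mul_apply_trunc 1 x n n le_rfl]
  have : ∀ m, contrib x n n ((1 : P.Completion).lift m) =
      if Fintype.card Unit = m then contrib x n n P.one else 0 := by
    intro m
    apply contrib_of_cls
    rw [Completion.mk_lift, one_apply]
  simp_rw [this]
  rw [Finset.sum_eq_single 1 (fun m _ hm => if_neg (by simpa using Ne.symm hm))
    (fun h => absurd (by simp; omega) h), if_pos (by simp)]
  rw [contrib_apply]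
  have hk : ∀ k : Unit → ℕ, P.cls n (P.comp P.one fun i => x.lift (k i)) =
      P.cls n (x.lift (k ())) := by
    intro k
    have : P.comp P.one (fun i => x.lift (k i)) =
        P.comp P.one (fun _ : Unit => x.lift (k ())) := rfl
    rw [this, ← cls_map n (Equiv.uniqueSigma fun _ : Unit => Fin (k ()))]
    rw [P.one_comp]
  rw [Finset.sum_eq_single (fun _ => n)]
  · rw [hk, cls_fin, Completion.mk_lift]
  · intro k _ hne
    rw [hk]
    refine cls_of_ne ?_ _
    simp only [Nat.card_eq_fintype_card, Fintype.card_fin]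
    intro h; apply hne; funext u; exact h
  · intro h; exfalso; apply h
    simp; omega

/-- The key step of associativity, for a fixed outer operation. -/
lemma contrib_mul (y z : P.Completion) (n m : ℕ) (w : P.obj (Fin m)) :
    ∑ k ∈ Fintype.piFinset fun _ : Fin m => Finset.Icc 1 n,
      contrib z n n (P.comp w fun i => y.lift (k i)) = contrib (y * z) n n w := by
  classical
  set S : Finset (Σ l : ℕ, Fin l → ℕ) :=
    (Finset.Icc 1 n).sigma fun l => Fintype.piFinset fun _ : Fin l => Finset.Icc 1 n with hS
  set G : ∀ s : (Σ l : ℕ, Fin l → ℕ), P.obj (Σ j : Fin s.1, Fin (s.2 j)) :=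
    fun s => P.comp (y.lift s.1) fun j => z.lift (s.2 j) with hG
  set c : (Σ l : ℕ, Fin l → ℕ) → ℕ := fun s => Nat.card (Σ j : Fin s.1, Fin (s.2 j)) with hc
  have hcpos : ∀ s ∈ S, 1 ≤ c s := by
    rintro ⟨l, p⟩ hs
    simp only [hS, Finset.mem_sigma, Fintype.mem_piFinset, Finset.mem_Icc] at hs
    have h2 : ∑ j : Fin l, 1 ≤ ∑ j, p j := Finset.sum_le_sum fun j _ => (hs.2 j).1
    simp [hc] at h2 ⊢
    omega
  -- expand the right-hand side
  have hR : contrib (y * z) n n w = ∑ r ∈ Fintype.piFinset fun _ : Fin m => S,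
      P.cls n (P.comp w fun i => G (r i)) := by
    rw [contrib_apply]
    have h1 : ∀ q ∈ Fintype.piFinset fun _ : Fin m => Finset.Icc 1 n,
        P.cls n (P.comp w fun i => (y * z).lift (q i)) =
        ∑ r ∈ Fintype.piFinset fun _ : Fin m => S,
          if q = fun i => c (r i) then P.cls n (P.comp w fun i => G (r i)) else 0 := by
      intro q hq
      simp only [Fintype.mem_piFinset, Finset.mem_Icc] at hq
      rw [cls_comp_congr (b := fun i => ∑ s ∈ S, clsRep (q i) (G s)),
        MultilinearMap.map_sum_finset, map_sum]
      · refine Finset.sum_congr rfl fun r _ => ?_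
        by_cases hr : q = fun i => c (r i)
        · rw [if_pos hr]
          have h2 : (fun i => clsRep (q i) (G (r i))) = fun i =>
              P.map (Finite.equivFinOfCardEq (congrFun hr i).symm) (G (r i)) := by
            funext i
            rw [clsRep, dif_pos]
          rw [h2, P.comp_map_right, cls_map]
        · rw [if_neg hr]
          have h3 : ∃ i, q i ≠ c (r i) := by
            by_contra hcon
            push Not at hcon
            exact hr (funext hcon)
          obtain ⟨i, hi⟩ := h3
          rw [(P.comp w).map_coord_zero i, map_zero]
          rw [clsRep, dif_neg (Ne.symm hi)]
      · intro i
        rw [Completion.mk_lift, map_sum]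
        simp_rw [mk_clsRep]
        rw [mul_apply_trunc y z n (q i) (hq i).2, hS, Finset.sum_sigma]
        rfl
    rw [Finset.sum_congr rfl h1, Finset.sum_comm]
    refine Finset.sum_congr rfl fun r hr => ?_
    simp only [Fintype.mem_piFinset] at hr
    rw [Finset.sum_ite_eq']
    split_ifs with h
    · rfl
    · symm
      refine cls_of_ne ?_ _
      simp only [Fintype.mem_piFinset, not_forall, Finset.mem_Icc] at h
      obtain ⟨i, hi⟩ := h
      have h4 := hcpos _ (hr i)
      have h5 := Finset.single_le_sum (f := fun i => c (r i)) (fun _ _ => Nat.zero_le _)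
        (Finset.mem_univ i)
      have h6 : Nat.card (Σ i : Fin m, Σ j : Fin (r i).1, Fin ((r i).2 j)) = ∑ i, c (r i) := by
        rw [Nat.card_sigma]
      rw [h6]
      omega
  rw [hR]
  simp_rw [contrib_apply]
  rw [Finset.sum_sigma']
  refine Finset.sum_bij'
    (fun a _ => fun i => (⟨a.1 i, fun j => a.2 ⟨i, j⟩⟩ : Σ l : ℕ, Fin l → ℕ))
    (fun r _ => ⟨fun i => (r i).1, fun p => (r p.1).2 p.2⟩) ?_ ?_ ?_ ?_ ?_
  · rintro ⟨k, p⟩ ha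
    simp only [Finset.mem_sigma, Fintype.mem_piFinset, Finset.mem_Icc, hS] at ha ⊢
    exact fun i => ⟨ha.1 i, fun j => ha.2 ⟨i, j⟩⟩
  · intro r hr
    simp only [Finset.mem_sigma, Fintype.mem_piFinset, Finset.mem_Icc, hS] at hr ⊢
    exact ⟨fun i => (hr i).1, fun p => (hr p.1).2 p.2⟩
  · rintro ⟨k, p⟩ ha
    rfl
  · intro r hr
    rfl
  · rintro ⟨k, p⟩ ha
    have := P.comp_assoc (K := fun i j => Fin (p ⟨i, j⟩)) w (fun i => y.lift (k i))
      (fun i j => z.lift (p ⟨i, j⟩))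
    simp only [hG]
    rw [← this, cls_map]

protected lemma mul_assoc' (x y z : P.Completion) : x * y * z = x * (y * z) := by
  classical
  funext n
  rw [mul_apply_trunc (x * y) z n n le_rfl, mul_apply_trunc x (y * z) n n le_rfl]
  have h1 : ∀ M ∈ Finset.Icc 1 n, contrib z n n ((x * y).lift M) =
      ∑ m ∈ Finset.Icc 1 n, ∑ k ∈ Fintype.piFinset fun _ : Fin m => Finset.Icc 1 n,
        if Fintype.card (Σ i, Fin (k i)) = M then
          contrib z n n (P.comp (x.lift m) fun i => y.lift (k i)) else 0 := by
    intro M hM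
    rw [contrib_lift (x * y) z n n M (∑ m ∈ Finset.Icc 1 n,
      ∑ k ∈ Fintype.piFinset fun _ : Fin m => Finset.Icc 1 n,
        clsRep M (P.comp (x.lift m) fun i => y.lift (k i)))]
    · simp_rw [map_sum]
      refine Finset.sum_congr rfl fun m _ => Finset.sum_congr rfl fun k _ => ?_
      exact contrib_of_cls z n n M _ _ (mk_clsRep M _)
    · simp_rw [map_sum, mk_clsRep]
      rw [mul_apply_trunc x y n M (Finset.mem_Icc.1 hM).2]
      rfl
  rw [Finset.sum_congr rfl h1, Finset.sum_comm]
  refine Finset.sum_congr rfl fun m hm => ?_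
  rw [Finset.sum_comm, ← contrib_mul]
  refine Finset.sum_congr rfl fun k hk => ?_
  rw [Finset.sum_ite_eq]
  split_ifs with h
  · rfl
  · symm
    apply contrib_eq_zero
    simp only [Fintype.mem_piFinset, Finset.mem_Icc] at hk hm h
    have h2 : ∑ i : Fin m, 1 ≤ ∑ i, k i := Finset.sum_le_sum fun i _ => (hk i).1
    simp at h h2 ⊢
    omega

/-- The product `×` makes the completion a monoid. -/
noncomputable instance : Monoid P.Completion where
  mul_assoc := AugOperad.mul_assoc'
  one_mul := AugOperad.one_mul'
  mul_one := AugOperad.mul_one'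

variable (P) in
/-- The group `𝖦_P` of invertible elements of the completion. -/
abbrev Gp : Type := P.Completionˣ

end completion

/-! ### Morphisms, ideals and quotients -/

/-- Morphisms of operads. -/
structure Hom (P Q : AugOperad) where
  app : ∀ I : Type, P.obj I →ₗ[ℚ] Q.obj I
  app_map : ∀ {I J : Type} (e : I ≃ J) (x : P.obj I), app J (P.map e x) = Q.map e (app I x)
  app_one : app Unit P.one = Q.one
  app_comp : ∀ {I : Type} [Finite I] {J : I → Type} [∀ i, Finite (J i)]
    (x : P.obj I) (y : ∀ i, P.obj (J i)),
    app _ (P.comp x y) = Q.comp (app I x) fun i => app (J i) (y i)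

namespace Hom

variable {P Q : AugOperad} (f : Hom P Q)

/-- The map induced on coinvariants. -/
noncomputable def coinv (n : ℕ) : P.Coinv n →ₗ[ℚ] Q.Coinv n :=
  Representation.Coinvariants.lift (P.rep n)
    (Representation.Coinvariants.mk (Q.rep n) ∘ₗ f.app (Fin n)) (by
      intro σ
      ext x
      change Representation.Coinvariants.mk (Q.rep n) (f.app _ (P.map σ x)) = _
      rw [f.app_map]
      exact Representation.Coinvariants.mk_self_apply (Q.rep n) σ _)

lemma coinv_mk (n : ℕ) (x : P.obj (Fin n)) :
    f.coinv n (Representation.Coinvariants.mk (P.rep n) x) =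
      Representation.Coinvariants.mk (Q.rep n) (f.app _ x) := by
  simp [coinv]

lemma coinv_cls (n : ℕ) {I : Type} [Finite I] (x : P.obj I) :
    f.coinv n (P.cls n x) = Q.cls n (f.app I x) := by
  by_cases h : Nat.card I = n
  · simp only [cls, dif_pos h, LinearMap.comp_apply, coinv_mk, f.app_map]
  · rw [cls_of_ne h, cls_of_ne h, map_zero]

/-- The map induced on completions is a morphism of monoids. -/
noncomputable def completion : P.Completion →* Q.Completion where
  toFun x := fun n => f.coinv n (x n)
  map_one' := by
    funext n
    simp only [one_apply, coinv_cls, f.app_one]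
  map_mul' x y := by
    funext n
    set X : Q.Completion := fun n => f.coinv n (x n) with hX
    set Y : Q.Completion := fun n => f.coinv n (y n) with hY
    change f.coinv n ((x * y) n) = (X * Y) n
    rw [mul_apply_trunc X Y n n le_rfl, mul_apply, map_sum]
    refine Finset.sum_congr rfl fun m _ => ?_
    rw [contrib_lift X Y n n m (f.app _ (x.lift m)) (by rw [hX, ← coinv_mk, x.mk_lift]),
      contrib_apply, map_sum]
    refine Finset.sum_congr rfl fun k _ => ?_
    rw [coinv_cls, f.app_comp]
    refine cls_comp_congr n k _ _ _ fun i => ?_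
    rw [← coinv_mk, y.mk_lift, Completion.mk_lift]

/-- The group morphism `𝖦_P → 𝖦_Q` induced by a morphism of operads. -/
noncomputable def gp : P.Gp →* Q.Gp := Units.map f.completion

end Hom

/-- A (proper) operadic ideal: subspaces stable under relabelling such that a composite lies in
the ideal as soon as one of the operations does. -/
structure OperadIdeal (P : AugOperad) where
  sub : ∀ I : Type, Submodule ℚ (P.obj I)
  map_mem : ∀ {I J : Type} (e : I ≃ J) {x : P.obj I}, x ∈ sub I → P.map e x ∈ sub J
  comp_mem_left : ∀ {I : Type} [Finite I] {J : I → Type} [∀ i, Finite (J i)]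
    {x : P.obj I} (y : ∀ i, P.obj (J i)), x ∈ sub I → P.comp x y ∈ sub (Σ i, J i)
  comp_mem_right : ∀ {I : Type} [Finite I] {J : I → Type} [∀ i, Finite (J i)]
    (x : P.obj I) {y : ∀ i, P.obj (J i)} (i : I), y i ∈ sub (J i) →
      P.comp x y ∈ sub (Σ i, J i)
  one_notMem : P.one ∉ sub Unit

namespace OperadIdeal

variable {P : AugOperad} (N : OperadIdeal P)

/-- The operations of the quotient operad. -/
abbrev Quot (I : Type) : Type := P.obj I ⧸ N.sub I

lemma mkQ_comp_congr {I : Type} [Finite I] {J : I → Type} [∀ i, Finite (J i)] (x : P.obj I)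
    (a b : ∀ i, P.obj (J i)) (h : ∀ i, (N.sub (J i)).mkQ (a i) = (N.sub (J i)).mkQ (b i)) :
    (N.sub (Σ i, J i)).mkQ (P.comp x a) = (N.sub (Σ i, J i)).mkQ (P.comp x b) := by
  classical
  have := Fintype.ofFinite I
  have key : ∀ s : Finset I, (N.sub (Σ i, J i)).mkQ
      (P.comp x (fun i => if i ∈ s then a i else b i)) =
        (N.sub (Σ i, J i)).mkQ (P.comp x b) := by
    intro s
    induction s using Finset.induction with
    | empty => simp
    | insert i s hi ih =>
      rw [← ih]
      set c : ∀ i, P.obj (J i) := fun i => if i ∈ s then a i else b i with hc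
      have h1 : (fun j => if j ∈ insert i s then a j else b j) = Function.update c i (a i) := by
        ext j
        by_cases hj : j = i
        · subst hj; simp
        · simp [hj, hc]
      have h2 : c = Function.update c i (b i) := by
        ext j
        by_cases hj : j = i
        · subst hj; simp [hc, hi]
        · simp [hj]
      rw [h1]
      conv_rhs => rw [h2]
      have hi' := h i
      simp only [Submodule.mkQ_apply] at hi' ⊢
      rw [Submodule.Quotient.eq] at hi' ⊢
      rw [← MultilinearMap.map_update_sub]
      exact N.comp_mem_right x i (by simpa using hi')
  simpa using key Finset.univ

/-- A representative of a class in the quotient. -/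
noncomputable def out {I : Type} (u : N.Quot I) : P.obj I :=
  Function.surjInv (N.sub I).mkQ_surjective u

lemma mkQ_out {I : Type} (u : N.Quot I) : (N.sub I).mkQ (N.out u) = u :=
  Function.surjInv_eq (N.sub I).mkQ_surjective u

lemma mkQ_comp_out_update {I : Type} [Finite I] [DecidableEq I] {J : I → Type}
    [∀ i, Finite (J i)] (x : P.obj I) (u : ∀ i, N.Quot (J i)) (i : I) (r : N.Quot (J i))
    (r' : P.obj (J i)) (hr : (N.sub (J i)).mkQ r' = r) :
    (N.sub (Σ i, J i)).mkQ (P.comp x fun j => N.out (Function.update u i r j)) =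
      (N.sub (Σ i, J i)).mkQ (P.comp x (Function.update (fun j => N.out (u j)) i r')) := by
  refine N.mkQ_comp_congr x _ _ fun j => ?_
  rw [mkQ_out]
  by_cases hj : j = i
  · subst hj; simp [← hr]
  · simp only [Function.update_of_ne hj, mkQ_out]

/-- The composition with a fixed outer operation descends to the quotients. -/
noncomputable def compAux {I : Type} [Finite I] {J : I → Type} [∀ i, Finite (J i)] :
    P.obj I →ₗ[ℚ] MultilinearMap ℚ (fun i => N.Quot (J i)) (N.Quot (Σ i, J i)) where
  toFun x :=
    { toFun := fun u => (N.sub (Σ i, J i)).mkQ (P.comp x fun i => N.out (u i))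
      map_update_add' := by
        intro _ u i p q
        rw [N.mkQ_comp_out_update x u i (p + q) (N.out p + N.out q) (by simp only [map_add, mkQ_out]),
          N.mkQ_comp_out_update x u i p (N.out p) (N.mkQ_out p),
          N.mkQ_comp_out_update x u i q (N.out q) (N.mkQ_out q),
          MultilinearMap.map_update_add, map_add]
      map_update_smul' := by
        intro _ u i t p
        rw [N.mkQ_comp_out_update x u i (t • p) (t • N.out p) (by simp only [map_smul, mkQ_out]),
          N.mkQ_comp_out_update x u i p (N.out p) (N.mkQ_out p),
          MultilinearMap.map_update_smul, map_smul] }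
  map_add' x y := by ext u; simp
  map_smul' t x := by ext u; simp

lemma compAux_mk {I : Type} [Finite I] {J : I → Type} [∀ i, Finite (J i)] (x : P.obj I)
    (y : ∀ i, P.obj (J i)) :
    N.compAux x (fun i => (N.sub (J i)).mkQ (y i)) = (N.sub (Σ i, J i)).mkQ (P.comp x y) := by
  refine N.mkQ_comp_congr x _ _ fun i => ?_
  rw [mkQ_out]

/-- The composition of the quotient operad. -/
noncomputable def quotComp {I : Type} [Finite I] {J : I → Type} [∀ i, Finite (J i)] :
    N.Quot I →ₗ[ℚ] MultilinearMap ℚ (fun i => N.Quot (J i)) (N.Quot (Σ i, J i)) :=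
  (N.sub I).liftQ N.compAux (by
    intro x hx
    rw [LinearMap.mem_ker]
    ext u
    change (N.sub (Σ i, J i)).mkQ _ = 0
    rw [Submodule.mkQ_apply, Submodule.Quotient.mk_eq_zero]
    exact N.comp_mem_left _ hx)

lemma quotComp_mk {I : Type} [Finite I] {J : I → Type} [∀ i, Finite (J i)] (x : P.obj I)
    (y : ∀ i, P.obj (J i)) :
    N.quotComp ((N.sub I).mkQ x) (fun i => (N.sub (J i)).mkQ (y i)) =
      (N.sub (Σ i, J i)).mkQ (P.comp x y) := by
  rw [← compAux_mk]; rfl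

/-- Relabelling in the quotient operad. -/
noncomputable def quotMap {I J : Type} (e : I ≃ J) : N.Quot I →ₗ[ℚ] N.Quot J :=
  (N.sub I).mapQ (N.sub J) (P.map e) fun _ hx => N.map_mem e hx

lemma quotMap_mk {I J : Type} (e : I ≃ J) (x : P.obj I) :
    N.quotMap e ((N.sub I).mkQ x) = (N.sub J).mkQ (P.map e x) := rfl

lemma exists_reps {I : Type} {J : I → Type} (u : ∀ i, N.Quot (J i)) :
    ∃ y : ∀ i, P.obj (J i), (fun i => (N.sub (J i)).mkQ (y i)) = u :=
  ⟨fun i => N.out (u i), funext fun i => N.mkQ_out (u i)⟩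

/-- The quotient of an operad by an ideal. -/
noncomputable def quotient : AugOperad where
  obj := N.Quot
  map := N.quotMap
  one := (N.sub Unit).mkQ P.one
  comp := N.quotComp
  map_refl {I} x := by
    obtain ⟨x, rfl⟩ := (N.sub I).mkQ_surjective x
    rw [quotMap_mk, P.map_refl]
  map_trans {I J K} e f x := by
    obtain ⟨x, rfl⟩ := (N.sub I).mkQ_surjective x
    simp only [quotMap_mk, P.map_trans]
  comp_map_left {I I' _ _ J _} e x y := by
    obtain ⟨x, rfl⟩ := (N.sub I).mkQ_surjective x
    obtain ⟨y, rfl⟩ := N.exists_reps y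
    rw [quotMap_mk, quotComp_mk, P.comp_map_left, N.quotComp_mk x fun i => y (e i), quotMap_mk]
  comp_map_right {I _ J J' _ _} e x y := by
    obtain ⟨x, rfl⟩ := (N.sub I).mkQ_surjective x
    obtain ⟨y, rfl⟩ := N.exists_reps y
    simp only [quotMap_mk]
    rw [N.quotComp_mk x fun i => P.map (e i) (y i), P.comp_map_right, quotComp_mk, quotMap_mk]
  one_comp {J _} y := by
    obtain ⟨y, rfl⟩ := (N.sub J).mkQ_surjective y
    rw [N.quotComp_mk P.one fun _ => y, quotMap_mk, P.one_comp]
  comp_one {I _} x := by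
    obtain ⟨x, rfl⟩ := (N.sub I).mkQ_surjective x
    rw [N.quotComp_mk x fun _ => P.one, quotMap_mk, P.comp_one]
  comp_assoc {I _ J _ K _} x y z := by
    obtain ⟨x, rfl⟩ := (N.sub I).mkQ_surjective x
    obtain ⟨y, rfl⟩ := N.exists_reps y
    have hz : ∀ i, ∃ z' : ∀ j, P.obj (K i j), (fun j => (N.sub (K i j)).mkQ (z' j)) = z i :=
      fun i => N.exists_reps (z i)
    choose z' hz' using hz
    obtain rfl : (fun i j => (N.sub (K i j)).mkQ (z' i j)) = z := funext hz'
    simp only [quotComp_mk, quotMap_mk]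
    rw [P.comp_assoc]
  arity_zero x := by
    obtain ⟨x, rfl⟩ := (N.sub Empty).mkQ_surjective x
    rw [P.arity_zero x, map_zero]
  arity_one x := by
    obtain ⟨x, rfl⟩ := (N.sub Unit).mkQ_surjective x
    obtain ⟨c, hc, -⟩ := P.arity_one x
    refine ⟨c, by rw [hc, map_smul], fun d hd => ?_⟩
    simp only at hd
    rw [hc, ← map_smul, Submodule.mkQ_apply, Submodule.mkQ_apply, Submodule.Quotient.eq,
      ← sub_smul] at hd
    by_contra hne
    have : c - d ≠ 0 := fun h => hne (by linarith)
    exact N.one_notMem (((N.sub Unit).smul_mem_iff this).1 hd)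

/-- The quotient map to the quotient operad. -/
noncomputable def proj : Hom P N.quotient where
  app I := (N.sub I).mkQ
  app_map _ _ := rfl
  app_one := rfl
  app_comp x y := (N.quotComp_mk x y).symm

end OperadIdeal

end AugOperad

/-! ## Rooted trees and the operad `PreLie` -/

/-- A rooted tree with vertex set `I`, edges being oriented towards the root: `parent v` is the end
of the edge starting at `v`, with the convention `parent root = root`. -/
structure RTree (I : Type) where
  root : I
  parent : I → I
  parent_root : parent root = root
  reaches : ∀ v, ∃ k : ℕ, parent^[k] v = root

namespace RTree

lemma eq_root {I : Type} (T : RTree I) {v : I} (h : T.parent v = v) : v = T.root := by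
  obtain ⟨k, hk⟩ := T.reaches v
  rwa [Function.iterate_fixed h] at hk

lemma ext_parent {I : Type} {T U : RTree I} (h : ∀ v, T.parent v = U.parent v) : T = U := by
  have hr : T.root = U.root := U.eq_root (by rw [← h, T.parent_root])
  have hp : T.parent = U.parent := funext h
  cases T; cases U
  simp only at hr hp
  subst hr hp
  rfl

instance {I : Type} [Finite I] : Finite (RTree I) :=
  Finite.of_injective (fun T : RTree I => T.parent) fun _ _ h => ext_parent fun v => congrFun h v

noncomputable instance {I : Type} [Finite I] : Fintype (RTree I) := Fintype.ofFinite _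

/-- Relabelling of the vertices. -/
def relabel {I J : Type} (e : I ≃ J) (T : RTree I) : RTree J where
  root := e T.root
  parent v := e (T.parent (e.symm v))
  parent_root := by simp [T.parent_root]
  reaches v := by
    obtain ⟨k, hk⟩ := T.reaches (e.symm v)
    refine ⟨k, ?_⟩
    have : ∀ m : ℕ, (fun v => e (T.parent (e.symm v)))^[m] v = e (T.parent^[m] (e.symm v)) := by
      intro m
      induction m with
      | zero => simp
      | succ m ih => rw [Function.iterate_succ_apply', ih, Function.iterate_succ_apply']; simp
    rw [this, hk]

@[simp] lemma relabel_root {I J : Type} (e : I ≃ J) (T : RTree I) :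
    (T.relabel e).root = e T.root := rfl

@[simp] lemma relabel_parent {I J : Type} (e : I ≃ J) (T : RTree I) (v : I) :
    (T.relabel e).parent (e v) = e (T.parent v) := by simp [relabel]

lemma relabel_refl {I : Type} (T : RTree I) : T.relabel (Equiv.refl I) = T := rfl

lemma relabel_trans {I J K : Type} (e : I ≃ J) (f : J ≃ K) (T : RTree I) :
    T.relabel (e.trans f) = (T.relabel e).relabel f := rfl

/-- Relabelling as a bijection. -/
def relabelEquiv {I J : Type} (e : I ≃ J) : RTree I ≃ RTree J where
  toFun := relabel e
  invFun := relabel e.symm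
  left_inv T := by rw [← relabel_trans, Equiv.self_trans_symm, relabel_refl]
  right_inv T := by rw [← relabel_trans, Equiv.symm_trans_self, relabel_refl]

open Classical in
/-- The tree obtained from `T` by replacing each vertex `i` by the tree `S i` and grafting back the
incoming edges of `i` on vertices of `S i`, as prescribed by `f`: an edge of `T` from `i` (not the
root) to its parent becomes an edge from the root of `S i` to the vertex `f i` of the tree that
replaces the parent. -/
noncomputable def graft {I : Type} {J : I → Type} (T : RTree I) (S : ∀ i, RTree (J i))
    (f : ∀ i : {i // i ≠ T.root}, J (T.parent i)) : RTree (Σ i, J i) where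
  root := ⟨T.root, (S T.root).root⟩
  parent p :=
    if p.2 = (S p.1).root then
      if h : p.1 = T.root then p else ⟨T.parent p.1, f ⟨p.1, h⟩⟩
    else ⟨p.1, (S p.1).parent p.2⟩
  parent_root := by simp
  reaches := by
    set F : (Σ i, J i) → Σ i, J i := fun p =>
      if p.2 = (S p.1).root then
        if h : p.1 = T.root then p else ⟨T.parent p.1, f ⟨p.1, h⟩⟩
      else ⟨p.1, (S p.1).parent p.2⟩ with hF
    have hin : ∀ (i : I) (k : ℕ) (v : J i), (S i).parent^[k] v = (S i).root →
        ∃ m : ℕ, F^[m] ⟨i, v⟩ = ⟨i, (S i).root⟩ := by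
      intro i k
      induction k with
      | zero => intro v hv; exact ⟨0, by simpa using hv⟩
      | succ k ih =>
        intro v hv
        by_cases h : v = (S i).root
        · exact ⟨0, by simp [h]⟩
        · obtain ⟨m, hm⟩ := ih ((S i).parent v) hv
          exact ⟨m + 1, by rw [Function.iterate_succ_apply]; simpa [hF, h] using hm⟩
    have hout : ∀ (k : ℕ) (i : I), T.parent^[k] i = T.root →
        ∀ v : J i, ∃ m : ℕ, F^[m] ⟨i, v⟩ = ⟨T.root, (S T.root).root⟩ := by
      intro k
      induction k with
      | zero =>
        intro i hi v
        obtain rfl : i = T.root := hi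
        obtain ⟨l, hl⟩ := (S T.root).reaches v
        exact hin _ l v hl
      | succ k ih =>
        intro i hi v
        obtain ⟨l, hl⟩ := (S i).reaches v
        obtain ⟨m, hm⟩ := hin _ l v hl
        by_cases h : i = T.root
        · subst h; exact ⟨m, hm⟩
        · obtain ⟨m', hm'⟩ := ih (T.parent i) hi (f ⟨i, h⟩)
          refine ⟨m' + (1 + m), ?_⟩
          rw [Function.iterate_add_apply, Function.iterate_add_apply, hm]
          simpa [hF, h] using hm'
    rintro ⟨i, v⟩
    obtain ⟨k, hk⟩ := T.reaches i
    exact hout k i hk v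

variable {I : Type} {J : I → Type}

lemma graft_parent_of_ne (T : RTree I) (S : ∀ i, RTree (J i))
    (f : ∀ i : {i // i ≠ T.root}, J (T.parent i)) {i : I} {v : J i} (h : v ≠ (S i).root) :
    (graft T S f).parent ⟨i, v⟩ = ⟨i, (S i).parent v⟩ := by
  simp [graft, h]

lemma graft_parent_root (T : RTree I) (S : ∀ i, RTree (J i))
    (f : ∀ i : {i // i ≠ T.root}, J (T.parent i)) {i : I} (h : i ≠ T.root) :
    (graft T S f).parent ⟨i, (S i).root⟩ = ⟨T.parent i, f ⟨i, h⟩⟩ := by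
  simp [graft, h]

/-- Characterization of the trees which occur in a composition. -/
structure Compat (T : RTree I) (S : ∀ i, RTree (J i)) (U : RTree (Σ i, J i)) : Prop where
  root_eq : U.root = ⟨T.root, (S T.root).root⟩
  inner : ∀ i v, v ≠ (S i).root → U.parent ⟨i, v⟩ = ⟨i, (S i).parent v⟩
  outer : ∀ i, i ≠ T.root → ∃ v, U.parent ⟨i, (S i).root⟩ = ⟨T.parent i, v⟩

lemma compat_graft (T : RTree I) (S : ∀ i, RTree (J i))
    (f : ∀ i : {i // i ≠ T.root}, J (T.parent i)) : Compat T S (graft T S f) where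
  root_eq := rfl
  inner _ _ h := graft_parent_of_ne T S f h
  outer _ h := ⟨_, graft_parent_root T S f h⟩

lemma Compat.exists_graft {T : RTree I} {S : ∀ i, RTree (J i)} {U : RTree (Σ i, J i)}
    (h : Compat T S U) : ∃ f, graft T S f = U := by
  choose f hf using h.outer
  refine ⟨fun i => f i.1 i.2, ext_parent ?_⟩
  rintro ⟨i, v⟩
  by_cases hv : v = (S i).root
  · subst hv
    by_cases hi : i = T.root
    · subst hi
      have h1 := U.parent_root
      rw [h.root_eq] at h1
      rw [h1]
      exact (graft T S _).parent_root
    · rw [graft_parent_root T S _ hi, hf i hi]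
  · rw [graft_parent_of_ne T S _ hv, h.inner i v hv]

lemma graft_injective (T : RTree I) (S : ∀ i, RTree (J i)) :
    Function.Injective (graft T S) := by
  intro f g h
  funext i
  have h1 := congrArg (fun U : RTree (Σ i, J i) => U.parent ⟨i.1, (S i.1).root⟩) h
  simp only [graft_parent_root T S _ i.2] at h1
  simpa using h1

/-- The composition of labelled rooted trees: the sum of all the ways to graft. -/
noncomputable def treeComp [Finite I] [∀ i, Finite (J i)] (T : RTree I) (S : ∀ i, RTree (J i)) :
    RTree (Σ i, J i) →₀ ℚ :=
  letI := Fintype.ofFinite (∀ i : {i // i ≠ T.root}, J (T.parent i))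
  ∑ f : ∀ i : {i // i ≠ T.root}, J (T.parent i), Finsupp.single (graft T S f) 1

open Classical in
lemma treeComp_apply [Finite I] [∀ i, Finite (J i)] (T : RTree I) (S : ∀ i, RTree (J i))
    (U : RTree (Σ i, J i)) : treeComp T S U = if Compat T S U then 1 else 0 := by
  rw [treeComp, Finsupp.finsetSum_apply]
  split_ifs with h
  · obtain ⟨f, rfl⟩ := h.exists_graft
    rw [Finset.sum_eq_single f]
    · simp
    · intro g _ hg
      rw [Finsupp.single_eq_of_ne]
      exact fun h => hg (graft_injective T S h).symm
    · simp
  · refine Finset.sum_eq_zero fun f _ => ?_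
    rw [Finsupp.single_eq_of_ne]
    rintro rfl
    exact h (compat_graft T S f)

/-- Relabelling extended linearly. -/
noncomputable def relabelLin {I J : Type} (e : I ≃ J) : (RTree I →₀ ℚ) →ₗ[ℚ] (RTree J →₀ ℚ) :=
  (Finsupp.domLCongr (relabelEquiv e)).toLinearMap

lemma relabelLin_single {I J : Type} (e : I ≃ J) (T : RTree I) (c : ℚ) :
    relabelLin e (Finsupp.single T c) = Finsupp.single (T.relabel e) c := by
  simp [relabelLin, relabelEquiv]

lemma relabelLin_apply {I J : Type} (e : I ≃ J) (x : RTree I →₀ ℚ) (U : RTree J) :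
    relabelLin e x U = x (U.relabel e.symm) := by
  simp [relabelLin, relabelEquiv, Finsupp.equivMapDomain_apply]

lemma relabelLin_apply_relabel {I J : Type} (e : I ≃ J) (x : RTree I →₀ ℚ) (U : RTree I) :
    relabelLin e x (U.relabel e) = x U := by
  rw [relabelLin_apply, ← relabel_trans, Equiv.self_trans_symm, relabel_refl]

/-- The multilinear extension of the composition of labelled rooted trees. -/
noncomputable def compLin {I : Type} [Finite I] {J : I → Type} [∀ i, Finite (J i)] :
    (RTree I →₀ ℚ) →ₗ[ℚ]
      MultilinearMap ℚ (fun i => RTree (J i) →₀ ℚ) (RTree (Σ i, J i) →₀ ℚ) :=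
  letI := Fintype.ofFinite I
  letI := Fintype.ofFinite (∀ i, RTree (J i))
  ∑ T : RTree I, ∑ S : ∀ i, RTree (J i),
    (Finsupp.lapply T : (RTree I →₀ ℚ) →ₗ[ℚ] ℚ).smulRight
      (((MultilinearMap.mkPiAlgebra ℚ I ℚ).compLinearMap
        fun i => (Finsupp.lapply (S i) : (RTree (J i) →₀ ℚ) →ₗ[ℚ] ℚ)).smulRight (treeComp T S))

open Classical in
lemma compLin_apply {I : Type} [Fintype I] {J : I → Type} [∀ i, Finite (J i)]
    (x : RTree I →₀ ℚ) (y : ∀ i, RTree (J i) →₀ ℚ) (W : RTree (Σ i, J i)) :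
    compLin x y W = ∑ T : RTree I, ∑ S : ∀ i, RTree (J i),
      x T * (∏ i, y i (S i)) * if Compat T S W then 1 else 0 := by
  simp only [compLin, LinearMap.sum_apply, sum_apply, Finsupp.finsetSum_apply,
    LinearMap.smulRight_apply, smul_apply, MultilinearMap.smulRight_apply,
    MultilinearMap.compLinearMap_apply, MultilinearMap.mkPiAlgebra_apply, Finsupp.smul_apply,
    Finsupp.lapply_apply, treeComp_apply, smul_eq_mul, ← mul_assoc]
  refine Finset.sum_congr rfl fun T _ => ?_
  refine Finset.sum_congr (by ext; simp) fun S _ => ?_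
  congr!

lemma compat_relabel_left {I I' : Type} {J : I' → Type} (e : I ≃ I') (T : RTree I)
    (S : ∀ i, RTree (J i)) (W : RTree (Σ i, J (e i))) :
    Compat (T.relabel e) S (W.relabel (Equiv.sigmaCongrLeft e)) ↔
      Compat T (fun i => S (e i)) W := by
  have hpar : ∀ i (v : J (e i)), (W.relabel (Equiv.sigmaCongrLeft e)).parent ⟨e i, v⟩ =
      Equiv.sigmaCongrLeft e (W.parent ⟨i, v⟩) := fun i v =>
    relabel_parent (Equiv.sigmaCongrLeft e) W ⟨i, v⟩
  constructor
  · intro h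
    refine ⟨(Equiv.sigmaCongrLeft e).injective h.root_eq, fun i v hv => ?_, fun i hi => ?_⟩
    · exact (Equiv.sigmaCongrLeft e).injective ((hpar i v).symm.trans (h.inner (e i) v hv))
    · obtain ⟨v, hv⟩ := h.outer (e i) (by simpa using hi)
      have h1 : ∀ (q : I') (hq : q = e (T.parent i)) (v : J q), ∃ v', (⟨q, v⟩ : Σ i, J i) =
          ⟨e (T.parent i), v'⟩ := by rintro _ rfl v; exact ⟨v, rfl⟩
      obtain ⟨v', hv'⟩ := h1 _ (relabel_parent e T i) v
      refine ⟨v', (Equiv.sigmaCongrLeft e).injective ?_⟩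
      rw [← hpar, hv, hv']; rfl
  · intro h
    refine ⟨?_, fun i' => ?_, fun i' => ?_⟩
    · rw [relabel_root, h.root_eq]; rfl
    · obtain ⟨i, rfl⟩ := e.surjective i'
      intro v hv
      rw [hpar, h.inner i v hv]; rfl
    · obtain ⟨i, rfl⟩ := e.surjective i'
      intro hi
      obtain ⟨v, hv⟩ := h.outer i (by simpa using hi)
      rw [hpar, hv, relabel_parent]
      exact ⟨v, rfl⟩

lemma compat_relabel_right {I : Type} {J J' : I → Type} (e : ∀ i, J i ≃ J' i) (T : RTree I)
    (S : ∀ i, RTree (J i)) (W : RTree (Σ i, J i)) :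
    Compat T (fun i => (S i).relabel (e i)) (W.relabel (Equiv.sigmaCongrRight e)) ↔
      Compat T S W := by
  have hpar : ∀ i (v : J i), (W.relabel (Equiv.sigmaCongrRight e)).parent ⟨i, e i v⟩ =
      Equiv.sigmaCongrRight e (W.parent ⟨i, v⟩) := fun i v =>
    relabel_parent (Equiv.sigmaCongrRight e) W ⟨i, v⟩
  constructor
  · intro h
    refine ⟨(Equiv.sigmaCongrRight e).injective h.root_eq, fun i v hv => ?_, fun i hi => ?_⟩
    · refine (Equiv.sigmaCongrRight e).injective ((hpar i v).symm.trans ?_)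
      rw [h.inner i (e i v) (by simpa using hv), relabel_parent]; rfl
    · obtain ⟨v, hv⟩ := h.outer i hi
      refine ⟨(e _).symm v, (Equiv.sigmaCongrRight e).injective ?_⟩
      rw [← hpar]
      refine hv.trans ?_
      simp
  · intro h
    refine ⟨?_, fun i v' => ?_, fun i hi => ?_⟩
    · rw [relabel_root, h.root_eq]; rfl
    · obtain ⟨v, rfl⟩ := (e i).surjective v'
      intro hv
      rw [hpar, h.inner i v (by simpa using hv), relabel_parent]; rfl
    · obtain ⟨v, hv⟩ := h.outer i hi
      exact ⟨e _ v, by rw [relabel_root, hpar, hv]; rfl⟩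

/-- The tree with one vertex. -/
def dot : RTree Unit where
  root := ()
  parent := id
  parent_root := rfl
  reaches _ := ⟨0, rfl⟩

instance : Unique (RTree Unit) where
  default := dot
  uniq _ := ext_parent fun _ => rfl

lemma compat_dot {J : Type} (T : RTree Unit) (S : Unit → RTree J) (W : RTree (Σ _ : Unit, J)) :
    Compat T S W ↔ S () = W.relabel (Equiv.uniqueSigma fun _ : Unit => J) := by
  have hpar : ∀ v : J, (W.relabel (Equiv.uniqueSigma fun _ : Unit => J)).parent v =
      (W.parent ⟨(), v⟩).2 := fun v => rfl
  constructor
  · intro h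
    refine ext_parent fun v => ?_
    rw [hpar]
    by_cases hv : v = (S ()).root
    · have h1 := W.parent_root
      rw [h.root_eq] at h1
      subst hv
      rw [(S ()).parent_root]
      exact congrArg (fun p : Σ _ : Unit, J => p.2) h1.symm
    · rw [h.inner () v hv]
  · intro h
    refine ⟨?_, fun i v hv => ?_, fun i hi => absurd rfl hi⟩
    · have : (S ()).root = W.root.2 := by rw [h]; rfl
      change W.root = ⟨(), (S ()).root⟩
      rw [this]
    · have : (S ()).parent v = (W.parent ⟨(), v⟩).2 := by rw [h]; rfl
      change W.parent ⟨(), v⟩ = ⟨(), (S ()).parent v⟩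
      rw [this]

lemma compat_dots {I : Type} (T : RTree I) (S : I → RTree Unit) (W : RTree (Σ _ : I, Unit)) :
    Compat T S W ↔ T = W.relabel (Equiv.sigmaUnique I fun _ => Unit) := by
  have hpar : ∀ v : I, (W.relabel (Equiv.sigmaUnique I fun _ => Unit)).parent v =
      (W.parent ⟨v, ()⟩).1 := fun v => rfl
  constructor
  · intro h
    refine ext_parent fun v => ?_
    rw [hpar]
    by_cases hv : v = T.root
    · have h1 := W.parent_root
      rw [h.root_eq] at h1
      subst hv
      rw [T.parent_root]
      exact congrArg (fun p : Σ _ : I, Unit => p.1) h1.symm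
    · obtain ⟨w, hw⟩ := h.outer v hv
      exact (congrArg (fun p : Σ _ : I, Unit => p.1) hw).symm
  · intro h
    refine ⟨?_, fun i v hv => absurd rfl hv, fun i hi => ⟨(), ?_⟩⟩
    · have : T.root = W.root.1 := by rw [h]; rfl
      rw [this]
    · have : T.parent i = (W.parent ⟨i, ()⟩).1 := by rw [h]; rfl
      rw [this]

section assoc

variable {K : ∀ i, J i → Type}

lemma compat_assoc_aux {T : RTree I} {S : ∀ i, RTree (J i)} {R : ∀ i j, RTree (K i j)}
    {W : RTree (Σ p : Σ i, J i, K p.1 p.2)} {U : RTree (Σ i, J i)} (h1 : Compat T S U)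
    (h2 : Compat U (fun p => R p.1 p.2) W) :
    ∃ V : ∀ i, RTree (Σ j, K i j), (∀ i, Compat (S i) (R i) (V i)) ∧
      Compat T V (W.relabel (Equiv.sigmaAssoc K)) := by
  have hpar : ∀ i j (k : K i j), (W.relabel (Equiv.sigmaAssoc K)).parent ⟨i, j, k⟩ =
      Equiv.sigmaAssoc K (W.parent ⟨⟨i, j⟩, k⟩) := fun i j k =>
    relabel_parent (Equiv.sigmaAssoc K) W ⟨⟨i, j⟩, k⟩
  have hg : ∀ i (j : {j // j ≠ (S i).root}), ∃ k : K i ((S i).parent j),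
      W.parent ⟨⟨i, j⟩, (R i j).root⟩ = ⟨⟨i, (S i).parent j⟩, k⟩ := by
    rintro i ⟨j, hj⟩
    obtain ⟨k, hk⟩ := h2.outer ⟨i, j⟩ (by
      rw [h1.root_eq]
      rintro h
      obtain ⟨rfl, h⟩ := Sigma.mk.inj_iff.1 h
      exact hj (eq_of_heq h))
    have h3 : ∀ q : Σ i, J i, q = ⟨i, (S i).parent j⟩ → ∀ k : K q.1 q.2,
        ∃ k' : K i ((S i).parent j), (⟨q, k⟩ : Σ p : Σ i, J i, K p.1 p.2) =
          ⟨⟨i, (S i).parent j⟩, k'⟩ := by rintro _ rfl k; exact ⟨k, rfl⟩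
    obtain ⟨k', hk'⟩ := h3 _ (h1.inner i j hj) k
    exact ⟨k', hk.trans hk'⟩
  choose g hg using hg
  refine ⟨fun i => graft (S i) (R i) (g i), fun i => compat_graft _ _ _, ?_, ?_, ?_⟩
  · rw [relabel_root, h2.root_eq]
    have h3 : ∀ q : Σ i, J i, q = ⟨T.root, (S T.root).root⟩ →
        Equiv.sigmaAssoc K ⟨q, (R q.1 q.2).root⟩ =
          ⟨T.root, (S T.root).root, (R T.root (S T.root).root).root⟩ := by
      rintro _ rfl; rfl
    exact h3 _ h1.root_eq
  · rintro i ⟨j, k⟩ hjk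
    rw [hpar]
    by_cases hk : k = (R i j).root
    · subst hk
      by_cases hj : j = (S i).root
      · subst hj; exact absurd rfl hjk
      · rw [hg i ⟨j, hj⟩, graft_parent_root _ _ _ hj]; rfl
    · rw [h2.inner ⟨i, j⟩ k hk, graft_parent_of_ne _ _ _ hk]; rfl
  · intro i hi
    obtain ⟨v, hv⟩ := h1.outer i hi
    obtain ⟨k, hk⟩ := h2.outer ⟨i, (S i).root⟩ (by
      rw [h1.root_eq]
      rintro h
      exact hi (Sigma.mk.inj_iff.1 h).1)
    have h3 : ∀ q : Σ i, J i, q = ⟨T.parent i, v⟩ → ∀ k : K q.1 q.2,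
        ∃ v', Equiv.sigmaAssoc K ⟨q, k⟩ = ⟨T.parent i, v'⟩ := by
      rintro _ rfl k; exact ⟨⟨v, k⟩, rfl⟩
    obtain ⟨v', hv'⟩ := h3 _ hv k
    refine ⟨v', ?_⟩
    rw [← hv', ← hk]
    exact hpar i (S i).root (R i (S i).root).root

lemma compat_assoc_aux' {T : RTree I} {S : ∀ i, RTree (J i)} {R : ∀ i j, RTree (K i j)}
    {W : RTree (Σ p : Σ i, J i, K p.1 p.2)} {V : ∀ i, RTree (Σ j, K i j)}
    (h1 : ∀ i, Compat (S i) (R i) (V i)) (h2 : Compat T V (W.relabel (Equiv.sigmaAssoc K))) :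
    ∃ U : RTree (Σ i, J i), Compat T S U ∧ Compat U (fun p => R p.1 p.2) W := by
  have hpar : ∀ i j (k : K i j), (W.relabel (Equiv.sigmaAssoc K)).parent ⟨i, j, k⟩ =
      Equiv.sigmaAssoc K (W.parent ⟨⟨i, j⟩, k⟩) := fun i j k =>
    relabel_parent (Equiv.sigmaAssoc K) W ⟨⟨i, j⟩, k⟩
  have hpar' : ∀ i j (k : K i j) q, (W.relabel (Equiv.sigmaAssoc K)).parent ⟨i, j, k⟩ = q →
      W.parent ⟨⟨i, j⟩, k⟩ = (Equiv.sigmaAssoc K).symm q := by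
    intro i j k q h
    rw [← h, hpar, Equiv.symm_apply_apply]
  have hf : ∀ i : {i // i ≠ T.root}, ∃ (j : J (T.parent i)) (k : K (T.parent i) j),
      W.parent ⟨⟨i, (S i).root⟩, (R i (S i).root).root⟩ = ⟨⟨T.parent i, j⟩, k⟩ := by
    rintro ⟨i, hi⟩
    obtain ⟨⟨j, k⟩, hjk⟩ := h2.outer i hi
    rw [(h1 i).root_eq] at hjk
    exact ⟨j, k, hpar' _ _ _ _ hjk⟩
  choose f f' hf using hf
  refine ⟨graft T S f, compat_graft _ _ _, ?_, ?_, ?_⟩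
  · apply (Equiv.sigmaAssoc K).injective
    rw [← relabel_root, h2.root_eq, (h1 _).root_eq]
    rfl
  · rintro ⟨i, j⟩ k hk
    refine hpar' i j k ⟨i, j, (R i j).parent k⟩ ?_
    · rw [h2.inner i ⟨j, k⟩, (h1 i).inner j k hk]
      rw [(h1 i).root_eq]
      intro h
      obtain ⟨rfl, h⟩ := Sigma.mk.inj_iff.1 h
      exact hk (eq_of_heq h)
  · rintro ⟨i, j⟩ hij
    by_cases hj : j = (S i).root
    · subst hj
      have hi : i ≠ T.root := by rintro rfl; exact hij rfl
      rw [graft_parent_root _ _ _ hi]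
      exact ⟨_, hf ⟨i, hi⟩⟩
    · rw [graft_parent_of_ne _ _ _ hj]
      obtain ⟨k, hk⟩ := (h1 i).outer j hj
      refine ⟨k, hpar' i j _ ⟨i, (S i).parent j, k⟩ ?_⟩
      rw [h2.inner i ⟨j, (R i j).root⟩, hk]
      rw [(h1 i).root_eq]
      intro h
      exact hj (Sigma.mk.inj_iff.1 h).1

lemma compat_unique_outer {T : RTree I} {S : ∀ i, RTree (J i)} {W : RTree (Σ i, J i)}
    {T' : RTree I} (h : Compat T S W) (h' : Compat T' S W) : T = T' := by
  have hr : T.root = T'.root := by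
    have := h.root_eq.symm.trans h'.root_eq
    exact (Sigma.mk.inj_iff.1 this).1
  refine ext_parent fun i => ?_
  by_cases hi : i = T.root
  · rw [hi, T.parent_root, hr, T'.parent_root]
  · obtain ⟨v, hv⟩ := h.outer i hi
    obtain ⟨v', hv'⟩ := h'.outer i (hr ▸ hi)
    exact (Sigma.mk.inj_iff.1 (hv.symm.trans hv')).1

lemma compat_unique_inner {T : RTree I} {S : ∀ i, RTree (J i)} {R : ∀ i j, RTree (K i j)}
    {W : RTree (Σ i, Σ j, K i j)} {V V' : ∀ i, RTree (Σ j, K i j)}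
    (h1 : ∀ i, Compat (S i) (R i) (V i)) (h2 : Compat T V W)
    (h1' : ∀ i, Compat (S i) (R i) (V' i)) (h2' : Compat T V' W) : V = V' := by
  funext i
  have hr : (V i).root = (V' i).root := by rw [(h1 i).root_eq, (h1' i).root_eq]
  refine ext_parent fun v => ?_
  by_cases hv : v = (V i).root
  · rw [hv, (V i).parent_root, hr, (V' i).parent_root]
  · have := (h2.inner i v hv).symm.trans (h2'.inner i v (hr ▸ hv))
    exact eq_of_heq (Sigma.mk.inj_iff.1 this).2

lemma sum_ite_unique {α : Type} [Fintype α] (p : α → Prop) [DecidablePred p] [Decidable (∃ a, p a)]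
    (h : ∀ a b, p a → p b → a = b) :
    (∑ a : α, if p a then (1 : ℚ) else 0) = if ∃ a, p a then 1 else 0 := by
  split_ifs with hex
  · obtain ⟨a, ha⟩ := hex
    rw [Finset.sum_eq_single a]
    · simp [ha]
    · intro b _ hb
      rw [if_neg]
      exact fun hpb => hb (h b a hpb ha)
    · simp
  · refine Finset.sum_eq_zero fun a _ => if_neg fun ha => hex ⟨a, ha⟩

open Classical in
lemma compLin_assoc [Finite I] [∀ i, Finite (J i)] [∀ i j, Finite (K i j)]
    (x : RTree I →₀ ℚ) (y : ∀ i, RTree (J i) →₀ ℚ) (z : ∀ i j, RTree (K i j) →₀ ℚ) :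
    relabelLin (Equiv.sigmaAssoc K) (compLin (compLin x y) fun p : Σ i, J i => z p.1 p.2) =
      compLin x fun i => compLin (y i) (z i) := by
  have := Fintype.ofFinite I
  have := fun i => Fintype.ofFinite (J i)
  ext W
  obtain ⟨W, rfl⟩ := (relabelEquiv (Equiv.sigmaAssoc K)).surjective W
  change relabelLin (Equiv.sigmaAssoc K) _ (W.relabel (Equiv.sigmaAssoc K)) =
    compLin x _ (W.relabel (Equiv.sigmaAssoc K))
  rw [relabelLin_apply_relabel]
  have hL : compLin (compLin x y) (fun p : Σ i, J i => z p.1 p.2) W =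
      ∑ T : RTree I, ∑ S : ∀ i, RTree (J i), ∑ R : ∀ i j, RTree (K i j),
        x T * (∏ i, y i (S i)) * (∏ i, ∏ j, z i j (R i j)) *
          ∑ U : RTree (Σ i, J i),
            if Compat T S U ∧ Compat U (fun p => R p.1 p.2) W then 1 else 0 := by
    rw [compLin_apply]
    simp only [compLin_apply, Finset.sum_mul, Finset.mul_sum]
    calc _ = ∑ U : RTree (Σ i, J i), ∑ R : ∀ p : Σ i, J i, RTree (K p.1 p.2),
          ∑ T : RTree I, ∑ S : ∀ i, RTree (J i),
            x T * (∏ i, y i (S i)) * (∏ p : Σ i, J i, z p.1 p.2 (R p)) *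
              if Compat T S U ∧ Compat U R W then 1 else 0 := by
            refine Finset.sum_congr rfl fun U _ => Finset.sum_congr (by ext; simp) fun R _ =>
              Finset.sum_congr rfl fun T _ => Finset.sum_congr rfl fun S _ => ?_
            by_cases h1 : Compat T S U <;> by_cases h2 : Compat U R W <;> simp [h1, h2]
      _ = ∑ U : RTree (Σ i, J i), ∑ R : ∀ i j, RTree (K i j),
          ∑ T : RTree I, ∑ S : ∀ i, RTree (J i),
            x T * (∏ i, y i (S i)) * (∏ i, ∏ j, z i j (R i j)) *
              if Compat T S U ∧ Compat U (fun p => R p.1 p.2) W then 1 else 0 := by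
            refine Finset.sum_congr rfl fun U _ => ?_
            refine Fintype.sum_equiv (Equiv.piCurry fun i (j : J i) => RTree (K i j)) _ _ ?_
            intro R
            refine Finset.sum_congr rfl fun T _ => Finset.sum_congr rfl fun S _ => ?_
            rw [Fintype.prod_sigma]
            rfl
      _ = _ := by
            rw [Finset.sum_comm]
            simp_rw [Finset.sum_comm (s := (Finset.univ : Finset (RTree (Σ i, J i))))]
            rw [Finset.sum_comm]
            refine Finset.sum_congr rfl fun T _ => ?_
            rw [Finset.sum_comm]
  have hR : compLin x (fun i => compLin (y i) (z i)) (W.relabel (Equiv.sigmaAssoc K)) =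
      ∑ T : RTree I, ∑ S : ∀ i, RTree (J i), ∑ R : ∀ i j, RTree (K i j),
        x T * (∏ i, y i (S i)) * (∏ i, ∏ j, z i j (R i j)) *
          ∑ V : ∀ i, RTree (Σ j, K i j),
            if (∀ i, Compat (S i) (R i) (V i)) ∧
              Compat T V (W.relabel (Equiv.sigmaAssoc K)) then 1 else 0 := by
    rw [compLin_apply]
    refine Finset.sum_congr rfl fun T _ => ?_
    have h1 : ∀ V : ∀ i, RTree (Σ j, K i j), ∏ i, compLin (y i) (z i) (V i) =
        ∑ S : ∀ i, RTree (J i), ∑ R : ∀ i j, RTree (K i j),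
          (∏ i, y i (S i)) * (∏ i, ∏ j, z i j (R i j)) *
            if ∀ i, Compat (S i) (R i) (V i) then 1 else 0 := by
      intro V
      simp only [compLin_apply]
      rw [Finset.prod_univ_sum, Fintype.piFinset_univ]
      refine Finset.sum_congr (by ext; simp) fun S _ => ?_
      rw [Finset.prod_univ_sum, Fintype.piFinset_univ]
      refine Finset.sum_congr (by ext; simp) fun R _ => ?_
      rw [Finset.prod_mul_distrib, Finset.prod_mul_distrib, Finset.prod_boole]
      simp
    simp only [h1, Finset.mul_sum, Finset.sum_mul]
    rw [Finset.sum_comm]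
    refine Finset.sum_congr rfl fun S _ => ?_
    rw [Finset.sum_comm]
    refine Finset.sum_congr rfl fun R _ => Finset.sum_congr rfl fun V _ => ?_
    by_cases h2 : ∀ i, Compat (S i) (R i) (V i) <;>
      by_cases h3 : Compat T V (W.relabel (Equiv.sigmaAssoc K)) <;> simp [h2, h3, mul_assoc]
  rw [hL, hR]
  refine Finset.sum_congr rfl fun T _ => Finset.sum_congr rfl fun S _ =>
    Finset.sum_congr rfl fun R _ => ?_
  congr 1
  rw [sum_ite_unique _ fun U U' h h' => compat_unique_outer h.2 h'.2,
    sum_ite_unique _ fun V V' h h' => compat_unique_inner h.1 h.2 h'.1 h'.2]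
  have : (∃ U, Compat T S U ∧ Compat U (fun p => R p.1 p.2) W) ↔
      ∃ V : ∀ i, RTree (Σ j, K i j), (∀ i, Compat (S i) (R i) (V i)) ∧
        Compat T V (W.relabel (Equiv.sigmaAssoc K)) :=
    ⟨fun ⟨_, h1, h2⟩ => compat_assoc_aux h1 h2, fun ⟨_, h1, h2⟩ => compat_assoc_aux' h1 h2⟩
  simp only [this]

end assoc

end RTree

open RTree in
open Classical in
/-- The operad `PreLie`: operations with inputs labelled by `I` are the rational linear
combinations of rooted trees with vertex set `I`. -/
noncomputable def PreLie : AugOperad where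
  obj I := RTree I →₀ ℚ
  map e := relabelLin e
  one := Finsupp.single dot 1
  comp := compLin
  map_refl x := by ext U; rw [relabelLin_apply]; rfl
  map_trans e f x := by ext U; simp only [relabelLin_apply]; rfl
  comp_map_left {I I' _ _ J _} e x y := by
    have := Fintype.ofFinite I
    have := Fintype.ofFinite I'
    ext W
    obtain ⟨W, rfl⟩ := (relabelEquiv (Equiv.sigmaCongrLeft e)).surjective W
    change compLin _ y (W.relabel _) = relabelLin _ _ (W.relabel _)
    rw [relabelLin_apply_relabel, compLin_apply, compLin_apply]
    symm
    refine Fintype.sum_equiv (relabelEquiv e) _ _ fun T => ?_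
    symm
    refine Fintype.sum_equiv (Equiv.piCongrLeft (fun i => RTree (J i)) e).symm _ _ fun S => ?_
    change relabelLin e x (T.relabel e) * _ * (if Compat (T.relabel e) S _ then _ else _) = _
    rw [relabelLin_apply_relabel]
    simp only [compat_relabel_left]
    rw [← Equiv.prod_comp e]
    rfl
  comp_map_right {I _ J J' _ _} e x y := by
    have := Fintype.ofFinite I
    ext W
    obtain ⟨W, rfl⟩ := (relabelEquiv (Equiv.sigmaCongrRight e)).surjective W
    change compLin _ _ (W.relabel _) = relabelLin _ _ (W.relabel _)
    rw [relabelLin_apply_relabel, compLin_apply, compLin_apply]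
    refine Finset.sum_congr rfl fun T _ => ?_
    symm
    refine Fintype.sum_equiv (Equiv.piCongrRight fun i => relabelEquiv (e i)) _ _ fun S => ?_
    change _ = x T * (∏ i, relabelLin (e i) (y i) ((S i).relabel (e i))) *
      (if Compat T (fun i => (S i).relabel (e i)) _ then _ else _)
    simp only [compat_relabel_right, relabelLin_apply_relabel]
  one_comp {J _} y := by
    ext W
    obtain ⟨W, rfl⟩ := (relabelEquiv (Equiv.uniqueSigma fun _ : Unit => J)).surjective W
    change relabelLin _ _ (W.relabel _) = y (W.relabel _)
    rw [relabelLin_apply_relabel, compLin_apply, Fintype.sum_unique]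
    simp only [compat_dot]
    rw [Finset.sum_eq_single fun _ => W.relabel (Equiv.uniqueSigma fun _ : Unit => J)]
    · rw [if_pos rfl, show (default : RTree Unit) = dot from rfl]
      simp
    · intro S _ hS
      rw [if_neg, mul_zero]
      intro h; exact hS (funext fun _ => h)
    · simp
  comp_one {I _} x := by
    have := Fintype.ofFinite I
    ext W
    obtain ⟨W, rfl⟩ := (relabelEquiv (Equiv.sigmaUnique I fun _ => Unit)).surjective W
    change relabelLin _ _ (W.relabel _) = x (W.relabel _)
    rw [relabelLin_apply_relabel, compLin_apply]
    simp only [compat_dots]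
    rw [Finset.sum_eq_single (W.relabel (Equiv.sigmaUnique I fun _ => Unit))]
    · rw [Finset.sum_eq_single fun _ => dot]
      · simp
      · intro S _ hS
        exact absurd (funext fun i => Subsingleton.elim _ _) hS
      · exact fun h => absurd (Finset.mem_univ _) h
    · intro T _ hT
      refine Finset.sum_eq_zero fun S _ => ?_
      rw [if_neg hT, mul_zero]
    · simp
  comp_assoc x y z := compLin_assoc x y z
  arity_zero x := Finsupp.ext fun T : RTree Empty => T.root.elim
  arity_one x := by
    refine ⟨x dot, ?_, ?_⟩
    · refine Finsupp.ext fun T : RTree Unit => ?_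
      obtain rfl : T = dot := Subsingleton.elim _ _
      change x dot = (x dot • Finsupp.single dot (1 : ℚ)) dot
      simp
    · intro c hc
      change x = c • Finsupp.single dot 1 at hc
      rw [hc]; simp

/-- The operation of `PreLie` given by a labelled rooted tree. -/
noncomputable def treeOp {I : Type} (T : RTree I) : PreLie.obj I :=
  (Finsupp.single T 1 : RTree I →₀ ℚ)

/-! ## Corollas and the quotient operad `Mu` -/

namespace RTree

/-- A corolla: every vertex other than the root is attached to the root. -/
def IsCorolla {I : Type} (T : RTree I) : Prop := ∀ v, T.parent v = T.root

/-- The corolla with `n + 1` vertices, rooted at `0`. -/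
def corolla (n : ℕ) : RTree (Fin (n + 1)) where
  root := 0
  parent _ := 0
  parent_root := rfl
  reaches _ := ⟨1, rfl⟩

lemma isCorolla_relabel {I J : Type} (e : I ≃ J) (T : RTree I) :
    (T.relabel e).IsCorolla ↔ T.IsCorolla := by
  constructor
  · intro h v
    have := h (e v)
    rw [relabel_parent, relabel_root] at this
    exact e.injective this
  · intro h v
    obtain ⟨v, rfl⟩ := e.surjective v
    rw [relabel_parent, relabel_root, h v]

lemma Compat.isCorolla {I : Type} {J : I → Type} {T : RTree I} {S : ∀ i, RTree (J i)}
    {W : RTree (Σ i, J i)} (h : Compat T S W) (hW : W.IsCorolla) :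
    T.IsCorolla ∧ ∀ i, (S i).IsCorolla := by
  refine ⟨fun i => ?_, fun i v => ?_⟩
  · by_cases hi : i = T.root
    · rw [hi, T.parent_root]
    · obtain ⟨v, hv⟩ := h.outer i hi
      rw [hW, h.root_eq] at hv
      exact (Sigma.mk.inj_iff.1 hv).1.symm
  · by_cases hv : v = (S i).root
    · rw [hv, (S i).parent_root]
    · have h1 := h.inner i v hv
      rw [hW, h.root_eq] at h1
      obtain ⟨rfl, h2⟩ := Sigma.mk.inj_iff.1 h1
      exact (eq_of_heq h2).symm

/-- The subspace spanned by the trees that are not corollas. -/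
noncomputable def nonCorollas (I : Type) : Submodule ℚ (RTree I →₀ ℚ) :=
  Submodule.span ℚ ((fun T => Finsupp.single T 1) '' {T : RTree I | ¬ T.IsCorolla})

lemma mem_nonCorollas {I : Type} (x : RTree I →₀ ℚ) :
    x ∈ nonCorollas I ↔ ∀ T : RTree I, T.IsCorolla → x T = 0 := by
  rw [nonCorollas, ← Finsupp.supported_eq_span_single, Finsupp.mem_supported']
  simp

lemma relabelLin_mem_nonCorollas {I J : Type} (e : I ≃ J) {x : RTree I →₀ ℚ}
    (hx : x ∈ nonCorollas I) : relabelLin e x ∈ nonCorollas J := by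
  refine (mem_nonCorollas _).2 fun T hT => ?_
  rw [relabelLin_apply]
  exact (mem_nonCorollas _).1 hx _ ((isCorolla_relabel _ _).2 hT)

lemma compLin_mem_nonCorollas_left {I : Type} [Finite I] {J : I → Type} [∀ i, Finite (J i)]
    {x : RTree I →₀ ℚ} (y : ∀ i, RTree (J i) →₀ ℚ) (hx : x ∈ nonCorollas I) :
    compLin x y ∈ nonCorollas (Σ i, J i) := by
  have := Fintype.ofFinite I
  refine (mem_nonCorollas _).2 fun W hW => ?_
  rw [compLin_apply]
  refine Finset.sum_eq_zero fun T _ => Finset.sum_eq_zero fun S _ => ?_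
  split_ifs with h
  · rw [(mem_nonCorollas _).1 hx T (h.isCorolla hW).1]; simp
  · simp

lemma compLin_mem_nonCorollas_right {I : Type} [Finite I] {J : I → Type} [∀ i, Finite (J i)]
    (x : RTree I →₀ ℚ) {y : ∀ i, RTree (J i) →₀ ℚ} (i : I) (hy : y i ∈ nonCorollas (J i)) :
    compLin x y ∈ nonCorollas (Σ i, J i) := by
  have := Fintype.ofFinite I
  refine (mem_nonCorollas _).2 fun W hW => ?_
  rw [compLin_apply]
  refine Finset.sum_eq_zero fun T _ => Finset.sum_eq_zero fun S _ => ?_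
  split_ifs with h
  · rw [Finset.prod_eq_zero (Finset.mem_univ i)
      ((mem_nonCorollas _).1 hy (S i) ((h.isCorolla hW).2 i))]
    simp
  · simp

end RTree

open RTree in
/-- The operadic ideal of `PreLie` spanned by the trees that are not corollas. -/
noncomputable def nonCorollaIdeal : AugOperad.OperadIdeal PreLie where
  sub := nonCorollas
  map_mem e _ hx := relabelLin_mem_nonCorollas e hx
  comp_mem_left y hx := compLin_mem_nonCorollas_left y hx
  comp_mem_right x _ i hy := compLin_mem_nonCorollas_right x i hy
  one_notMem h := by
    have := (mem_nonCorollas _).1 h dot fun _ => rfl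
    change Finsupp.single dot (1 : ℚ) dot = 0 at this
    simp at this

/-- The operad `Mu` on corollas. -/
noncomputable def Mu : AugOperad := nonCorollaIdeal.quotient

/-- The quotient map `ψ : PreLie → Mu`. -/
noncomputable def psi : AugOperad.Hom PreLie Mu := nonCorollaIdeal.proj

/-- The class `νₙ` in `Mu` of the corolla with `n + 1` vertices. -/
noncomputable def nu (n : ℕ) : Mu.Coinv (n + 1) :=
  Mu.cls (n + 1) (psi.app (Fin (n + 1)) (treeOp (RTree.corolla n)))

open Classical in
/-- The coefficient of (the isomorphism class of) the rooted tree `T` with `n` vertices in an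
element of the coinvariants of `PreLie(n)`, in the basis of isomorphism classes of rooted trees. -/
noncomputable def treeCoeff {n : ℕ} (T : RTree (Fin n)) : PreLie.Coinv n →ₗ[ℚ] ℚ :=
  Representation.Coinvariants.lift (PreLie.rep n)
    (Finsupp.linearCombination ℚ
      fun U : RTree (Fin n) => if ∃ σ : Equiv.Perm (Fin n), T.relabel σ = U then (1 : ℚ) else 0)
    (by
      intro σ
      refine Finsupp.lhom_ext fun (U : RTree (Fin n)) c => ?_
      change Finsupp.linearCombination ℚ _ (RTree.relabelLin σ (Finsupp.single U c)) = _
      rw [RTree.relabelLin_single, Finsupp.linearCombination_single,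
        Finsupp.linearCombination_single]
      have : (∃ τ : Equiv.Perm (Fin n), T.relabel τ = U.relabel σ) ↔
          ∃ τ : Equiv.Perm (Fin n), T.relabel τ = U := by
        constructor
        · rintro ⟨τ, h⟩
          refine ⟨τ.trans σ.symm, ?_⟩
          rw [RTree.relabel_trans, h, ← RTree.relabel_trans, Equiv.self_trans_symm,
            RTree.relabel_refl]
        · rintro ⟨τ, rfl⟩
          exact ⟨τ.trans σ, RTree.relabel_trans _ _ _⟩
      simp only [this])

/-! ## The element `exp*` -/

/-- The generator `v` of the completed free pre-Lie algebra on one generator, which is identified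
with the completion of `PreLie`: the tree with one vertex. -/
noncomputable def generator : PreLie.Completion :=
  fun n => PreLie.cls n (treeOp RTree.dot)

/-- The pre-Lie product `a ← b` on the completed free pre-Lie algebra: composition in the operad
with the tree with two vertices, `a` being inserted at the root and `b` at the other vertex. On
trees, `a ← b` is the sum of all graftings of the root of `b` on a vertex of `a`. -/
noncomputable def preLieMul (a b : PreLie.Completion) : PreLie.Completion :=
  fun n => ∑ k ∈ Fintype.piFinset fun _ : Fin 2 => Finset.Icc 1 n,
    PreLie.cls n (PreLie.comp (treeOp (RTree.corolla 1))
      fun i => (![a, b] i).lift (k i))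

/-- `rightIterate k` is the iterated product `((v ← v) ← ⋯) ← v` with `k + 1` factors. -/
noncomputable def rightIterate : ℕ → PreLie.Completion
  | 0 => generator
  | k + 1 => preLieMul (rightIterate k) generator

/-- The series `exp* = ∑_{k ≥ 1} v^{←k} / k!`. Since `v^{←k}` is homogeneous of degree `k`, only
the terms with `k ≤ n` contribute to the component of arity `n`. -/
noncomputable def expStar : PreLie.Completion :=
  fun n => ∑ k ∈ Finset.range n, (1 / ((k + 1).factorial : ℚ)) • rightIterate k n

/-! ## The semidirect product -/

/-- The semidirect product `ℚˣ ⋉ (1 + xℚ⟦x⟧)`, with elements `(λ, f)`. -/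
@[ext]
structure ScaledSeries where
  scale : ℚˣ
  series : ℚ⟦X⟧
  constantCoeff_series : PowerSeries.constantCoeff series = 1

namespace ScaledSeries

/-- The product `(λ, f(x)) (θ, g(x)) = (λ θ, f(θ x) g(x))`. -/
noncomputable instance : Mul ScaledSeries where
  mul a b :=
    { scale := a.scale * b.scale
      series := PowerSeries.rescale (b.scale : ℚ) a.series * b.series
      constantCoeff_series := by
        have h : PowerSeries.constantCoeff (PowerSeries.rescale (b.scale : ℚ) a.series) = 1 := by
          rw [← PowerSeries.coeff_zero_eq_constantCoeff_apply, PowerSeries.coeff_rescale]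
          simp [a.constantCoeff_series]
        rw [map_mul, h, b.constantCoeff_series, one_mul] }

noncomputable instance : One ScaledSeries where
  one := ⟨1, 1, by simp⟩

noncomputable instance : Inv ScaledSeries where
  inv a :=
    { scale := a.scale⁻¹
      series := PowerSeries.rescale ((a.scale⁻¹ : ℚˣ) : ℚ) a.series⁻¹
      constantCoeff_series := by
        rw [← PowerSeries.coeff_zero_eq_constantCoeff_apply, PowerSeries.coeff_rescale]
        simp [a.constantCoeff_series] }

lemma mul_scale (a b : ScaledSeries) : (a * b).scale = a.scale * b.scale := rfl

lemma mul_series (a b : ScaledSeries) :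
    (a * b).series = PowerSeries.rescale (b.scale : ℚ) a.series * b.series := rfl

lemma one_scale : (1 : ScaledSeries).scale = 1 := rfl

lemma one_series : (1 : ScaledSeries).series = 1 := rfl

lemma inv_scale (a : ScaledSeries) : a⁻¹.scale = a.scale⁻¹ := rfl

lemma inv_series (a : ScaledSeries) :
    a⁻¹.series = PowerSeries.rescale ((a.scale⁻¹ : ℚˣ) : ℚ) a.series⁻¹ := rfl

noncomputable instance : Group ScaledSeries :=
  Group.ofLeftAxioms
    (by
      intro a b c
      refine ScaledSeries.ext (by simp only [mul_scale, mul_assoc]) ?_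
      simp only [mul_series, mul_scale, map_mul, PowerSeries.rescale_rescale, Units.val_mul,
        mul_assoc])
    (by
      intro a
      refine ScaledSeries.ext (by simp only [mul_scale, one_scale, one_mul]) ?_
      simp only [mul_series, one_series, map_one, one_mul])
    (by
      intro a
      refine ScaledSeries.ext (by simp only [mul_scale, one_scale, inv_scale, inv_mul_cancel]) ?_
      simp only [mul_series, one_series, inv_series, PowerSeries.rescale_rescale]
      rw [← Units.val_mul, inv_mul_cancel, Units.val_one, PowerSeries.rescale_one,
        RingHom.id_apply, PowerSeries.inv_mul_cancel]
      rw [a.constantCoeff_series]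
      exact one_ne_zero)

end ScaledSeries

/-!
The proof reads off everything from the coefficients of corollas. The starting point is a remark on
grafting (`RTree.exists_isCorolla_compat_iff`): a composite `γ(T; (Sᵢ))` contains a corolla only if
`T` and all the `Sᵢ` are corollas and every `Sᵢ` inserted away from the root of `T` has a single
vertex, and then it contains exactly one. Hence, if `F x = ∑ₙ cₙ tⁿ` records the coefficients `cₙ`
in `x` of the corollas with `n + 1` vertices, a corolla with `a + 1` vertices in `x` contributes to
`x × y` the series `tᵃ F_y(0)ᵃ F_y(t)`: one factor is inserted at the root, and the `a` other ones
have arity one. This is `corollaSeries_mul`,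

  `F (x × y)(t) = (F x)(F_y(0) t) · (F y)(t)`,

which is the product of the semidirect product under `(λ, f) ↔ λ f`. As the coinvariants of `Mu` in
arity `n + 1` form the line spanned by `νₙ` (`apply_succ_eq_smul_nu`, `muCoeff_nu`), the series `F`
identifies the completion of `Mu` with `ℚ⟦X⟧`, and its invertible elements with the series whose
constant term is nonzero; this gives `muGpEquiv`.

In any augmented operad an element of the completion with nonzero arity one part is invertible
(`AugOperad.isUnit_of_apply_one`): a left inverse can be computed arity by arity, since in
`(y × x)ₙ` the component `yₙ` is multiplied by a nonzero scalar and only lower components of `y`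
occur otherwise; the left inverse itself has a left inverse for the same reason. So `exp*` is
invertible.

Finally, grafting one vertex on a tree yields a corolla only from a corolla and only at its root, so
the iterated product with `k + 1` factors contains its corolla exactly once. Therefore
`F(exp*) = ∑ₙ tⁿ / (n + 1)! = (exp t - 1) / t`. For elements whose series has constant term `1` the
twist disappears, so `F(log*)` is the inverse `t / (exp t - 1)` of this series, the generating series
of the Bernoulli numbers.
-/

/-! ### Corollas in a composite of trees -/

namespace RTree

open Classical in
/-- The sum of the coefficients of the corollas in a linear combination of labelled trees. -/
noncomputable def corollaSumAux (I : Type) [Finite I] : (RTree I →₀ ℚ) →ₗ[ℚ] ℚ :=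
  ∑ T : RTree I, if T.IsCorolla then Finsupp.lapply T else 0

open Classical in
lemma corollaSumAux_apply {I : Type} [Finite I] (x : RTree I →₀ ℚ) :
    corollaSumAux I x = ∑ T : RTree I, if T.IsCorolla then x T else 0 := by
  rw [corollaSumAux, LinearMap.sum_apply]
  refine Finset.sum_congr rfl fun T _ => ?_
  split_ifs <;> simp

open Classical in
lemma corollaSumAux_single {I : Type} [Finite I] (T : RTree I) (c : ℚ) :
    corollaSumAux I (Finsupp.single T c) = if T.IsCorolla then c else 0 := by
  rw [corollaSumAux_apply, Finset.sum_eq_single T]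
  · simp
  · intro U _ hU
    rw [Finsupp.single_eq_of_ne hU]
    simp
  · simp

lemma corollaSumAux_relabelLin {I J : Type} [Finite I] [Finite J] (e : I ≃ J) (x : RTree I →₀ ℚ) :
    corollaSumAux J (relabelLin e x) = corollaSumAux I x := by
  classical
  rw [corollaSumAux_apply, corollaSumAux_apply]
  symm
  refine Fintype.sum_equiv (relabelEquiv e) _ _ fun T => ?_
  change _ = if (T.relabel e).IsCorolla then relabelLin e x (T.relabel e) else 0
  rw [relabelLin_apply_relabel]
  simp only [isCorolla_relabel]

lemma isCorolla_corolla (n : ℕ) : (corolla n).IsCorolla := fun _ => rfl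

lemma IsCorolla.ext {I : Type} {T U : RTree I} (hT : T.IsCorolla) (hU : U.IsCorolla)
    (h : T.root = U.root) : T = U :=
  ext_parent fun v => by rw [hT, hU, h]

lemma isCorolla_iff_exists_relabel {n : ℕ} (U : RTree (Fin (n + 1))) :
    U.IsCorolla ↔ ∃ σ : Equiv.Perm (Fin (n + 1)), (corolla n).relabel σ = U := by
  constructor
  · intro h
    refine ⟨Equiv.swap 0 U.root,
      IsCorolla.ext ((isCorolla_relabel _ _).2 (isCorolla_corolla n)) h ?_⟩
    rw [relabel_root]
    exact Equiv.swap_apply_left _ _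
  · rintro ⟨σ, rfl⟩
    exact (isCorolla_relabel _ _).2 (isCorolla_corolla n)

/-- A corolla can be obtained by composition only from corollas, and only if all the operations
that are not inserted at the root have arity one: an edge inside an inserted tree ends at the root
of the composite. -/
lemma exists_isCorolla_compat_iff {I : Type} {J : I → Type} (T : RTree I)
    (S : ∀ i, RTree (J i)) :
    (∃ W : RTree (Σ i, J i), W.IsCorolla ∧ Compat T S W) ↔
      (T.IsCorolla ∧ ∀ i, i ≠ T.root → Subsingleton (J i)) ∧ ∀ i, (S i).IsCorolla := by
  constructor
  · rintro ⟨W, hW, h⟩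
    refine ⟨⟨(h.isCorolla hW).1, fun i hi => ?_⟩, (h.isCorolla hW).2⟩
    have key : ∀ v : J i, v = (S i).root := by
      intro v
      by_contra hv
      have h1 := h.inner i v hv
      rw [hW, h.root_eq] at h1
      exact hi (Sigma.mk.inj_iff.1 h1).1.symm
    exact ⟨fun v w => (key v).trans (key w).symm⟩
  · rintro ⟨⟨hT, hJ⟩, hS⟩
    refine ⟨⟨⟨T.root, (S T.root).root⟩, fun _ => ⟨T.root, (S T.root).root⟩, rfl,
      fun _ => ⟨1, rfl⟩⟩, fun _ => rfl, rfl, fun i v hv => ?_, fun i _ => ?_⟩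
    · by_cases hi : i = T.root
      · subst hi
        change (⟨T.root, _⟩ : Σ i, J i) = _
        rw [hS]
      · exact absurd ((hJ i hi).elim _ _) hv
    · change ∃ v, (⟨T.root, (S T.root).root⟩ : Σ i, J i) = _
      rw [hT i]
      exact ⟨_, rfl⟩

end RTree

open AugOperad RTree

/-! ### The series of corollas -/

/-- Linear maps on the operations of `PreLie` are determined by their values on trees. -/
lemma preLie_linearMap_ext {I : Type} {W : Type} [AddCommGroup W] [Module ℚ W]
    {f g : PreLie.obj I →ₗ[ℚ] W} (h : ∀ T : RTree I, f (treeOp T) = g (treeOp T)) : f = g :=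
  Finsupp.lhom_ext' (φ := (f : (RTree I →₀ ℚ) →ₗ[ℚ] W)) (ψ := (g : (RTree I →₀ ℚ) →ₗ[ℚ] W))
    fun T => LinearMap.ext_ring (h T)

/-- The sum of the coefficients of the corollas in an operation of `PreLie`: the functional
`RTree.corollaSumAux` with its domain regarded as a component of the operad. -/
noncomputable def corollaSum (I : Type) [Finite I] : PreLie.obj I →ₗ[ℚ] ℚ :=
  corollaSumAux I

open Classical in
lemma corollaSum_treeOp {I : Type} [Finite I] (T : RTree I) :
    corollaSum I (treeOp T) = if T.IsCorolla then 1 else 0 :=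
  corollaSumAux_single T 1

lemma corollaSum_map {I J : Type} [Finite I] [Finite J] (e : I ≃ J) (x : PreLie.obj I) :
    corollaSum J (PreLie.map e x) = corollaSum I x :=
  corollaSumAux_relabelLin e x

open Classical in
/-- The corollas in a composite whose outer operation is a tree. -/
lemma corollaSum_comp_treeOp {I : Type} [Fintype I] {J : I → Type} [∀ i, Finite (J i)]
    (T : RTree I) (y : ∀ i, PreLie.obj (J i)) :
    corollaSum (Σ i, J i) (PreLie.comp (treeOp T) y) =
      if T.IsCorolla ∧ ∀ i, i ≠ T.root → Subsingleton (J i) then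
        ∏ i, corollaSum (J i) (y i) else 0 := by
  suffices h : ∀ y : ∀ i, RTree (J i) →₀ ℚ,
      corollaSumAux (Σ i, J i) (compLin (Finsupp.single T 1) y) =
      if T.IsCorolla ∧ ∀ i, i ≠ T.root → Subsingleton (J i) then
        ∏ i, corollaSumAux (J i) (y i) else 0 from h y
  clear y
  intro y
  have hprod : ∏ i, corollaSumAux (J i) (y i) = ∑ S : ∀ i, RTree (J i),
      (∏ i, y i (S i)) * if ∀ i, (S i).IsCorolla then 1 else 0 := by
    simp only [corollaSumAux_apply]
    rw [Finset.prod_univ_sum, Fintype.piFinset_univ]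
    refine Finset.sum_congr (by ext; simp) fun S _ => ?_
    split_ifs with h
    · rw [mul_one]
      exact Finset.prod_congr rfl fun i _ => if_pos (h i)
    · push Not at h
      obtain ⟨i, hi⟩ := h
      rw [Finset.prod_eq_zero (Finset.mem_univ i) (if_neg hi), mul_zero]
  have hW : ∀ W : RTree (Σ i, J i),
      (if W.IsCorolla then compLin (Finsupp.single T 1) y W else 0) =
      ∑ S : ∀ i, RTree (J i), (∏ i, y i (S i)) *
        if W.IsCorolla ∧ Compat T S W then 1 else 0 := by
    intro W
    rw [compLin_apply, Finset.sum_eq_single T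
      (fun U _ hU => by simp [Finsupp.single_eq_of_ne hU]) (by simp)]
    by_cases h : W.IsCorolla <;> simp [h]
  -- a corolla is determined by its root, which is prescribed by compatibility
  have huniq : ∀ S : ∀ i, RTree (J i),
      (∑ W : RTree (Σ i, J i), if W.IsCorolla ∧ Compat T S W then (1 : ℚ) else 0) =
      if (T.IsCorolla ∧ ∀ i, i ≠ T.root → Subsingleton (J i)) ∧ ∀ i, (S i).IsCorolla
        then 1 else 0 := by
    intro S
    rw [sum_ite_unique _ fun W W' h h' =>
      IsCorolla.ext h.1 h'.1 (h.2.root_eq.trans h'.2.root_eq.symm)]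
    simp only [exists_isCorolla_compat_iff]
  rw [corollaSumAux_apply]
  simp only [hW]
  rw [Finset.sum_comm]
  simp only [← Finset.mul_sum, huniq]
  rw [hprod]
  split_ifs with h
  · simp only [and_iff_right h]
  · simp [h]

lemma treeCoeff_corolla_mk (n : ℕ) (x : PreLie.obj (Fin (n + 1))) :
    treeCoeff (corolla n) (Representation.Coinvariants.mk (PreLie.rep (n + 1)) x) =
      corollaSum (Fin (n + 1)) x := by
  classical
  refine LinearMap.congr_fun (f := treeCoeff (corolla n) ∘ₗ
    Representation.Coinvariants.mk (PreLie.rep (n + 1))) (preLie_linearMap_ext fun T => ?_) x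
  rw [corollaSum_treeOp]
  change Finsupp.linearCombination ℚ _ (Finsupp.single T (1 : ℚ)) = _
  rw [Finsupp.linearCombination_single, one_smul]
  simp only [← isCorolla_iff_exists_relabel]

open Classical in
lemma treeCoeff_corolla_cls (n : ℕ) {I : Type} [Finite I] (x : PreLie.obj I) :
    treeCoeff (corolla n) (PreLie.cls (n + 1) x) =
      if Nat.card I = n + 1 then corollaSum I x else 0 := by
  split_ifs with h
  · rw [cls, dif_pos h, LinearMap.comp_apply, treeCoeff_corolla_mk, corollaSum_map]
  · rw [cls_of_ne h, map_zero]

lemma corollaSum_lift (x : PreLie.Completion) (n : ℕ) :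
    corollaSum (Fin (n + 1)) (x.lift (n + 1)) = treeCoeff (corolla n) (x (n + 1)) := by
  rw [← x.mk_lift (n + 1), treeCoeff_corolla_mk]

/-- The generating series `∑ₙ cₙ xⁿ` of the coefficients `cₙ` of the corollas with `n + 1`
vertices. -/
noncomputable def corollaSeries (x : PreLie.Completion) : ℚ⟦X⟧ :=
  PowerSeries.mk fun n => treeCoeff (corolla n) (x (n + 1))

lemma coeff_corollaSeries (x : PreLie.Completion) (n : ℕ) :
    PowerSeries.coeff n (corollaSeries x) = treeCoeff (corolla n) (x (n + 1)) :=
  PowerSeries.coeff_mk _ _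

open Classical in
/-- The coefficient of a corolla in a composite of series `yᵢ`, the outer operation being a tree
`T`. If `T` is a corolla, the only family of arities that contributes is `1` away from the root of
`T` and whatever remains at the root. -/
lemma treeCoeff_corolla_sum_comp (n : ℕ) {I : Type} [Fintype I] (hI : Fintype.card I ≤ n + 1)
    (T : RTree I) (y : I → PreLie.Completion) :
    treeCoeff (corolla n) (∑ k ∈ Fintype.piFinset fun _ : I => Finset.Icc 1 (n + 1),
      PreLie.cls (n + 1) (PreLie.comp (treeOp T) fun i => (y i).lift (k i))) =
    if T.IsCorolla then
      PowerSeries.coeff (n + 1 - Fintype.card I) (corollaSeries (y T.root)) *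
        ∏ i ∈ Finset.univ.erase T.root, PowerSeries.coeff 0 (corollaSeries (y i)) else 0 := by
  have hpos : 0 < Fintype.card I := Fintype.card_pos_iff.2 ⟨T.root⟩
  -- among the arities of total `n + 1`, exactly one family allows a corolla
  have hiff : ∀ k ∈ Fintype.piFinset fun _ : I => Finset.Icc 1 (n + 1),
      (∑ i, k i = n + 1 ∧ ∀ i, i ≠ T.root → Subsingleton (Fin (k i))) ↔
        k = Function.update (fun _ => 1) T.root (n + 1 - Fintype.card I + 1) := by
    intro k hk
    simp only [Fintype.mem_piFinset, Finset.mem_Icc] at hk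
    have hsum : (∀ i, i ≠ T.root → k i = 1) → ∑ i, k i = k T.root + (Fintype.card I - 1) := by
      intro h
      rw [← Finset.add_sum_erase _ _ (Finset.mem_univ T.root),
        Finset.sum_congr rfl fun i hi => h i (Finset.ne_of_mem_erase hi)]
      simp
    constructor
    · rintro ⟨h1, h2⟩
      have h3 : ∀ i, i ≠ T.root → k i = 1 := fun i hi =>
        le_antisymm (Fin.subsingleton_iff_le_one.1 (h2 i hi)) (hk i).1
      have h4 := hsum h3
      funext i
      by_cases hi : i = T.root
      · subst hi; rw [Function.update_self]; omega
      · rw [Function.update_of_ne hi, h3 i hi]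
    · intro h
      have h3 : ∀ i, i ≠ T.root → k i = 1 := fun i hi => by rw [h, Function.update_of_ne hi]
      have h5 : k T.root = n + 1 - Fintype.card I + 1 := by rw [h, Function.update_self]
      have h4 := hsum h3
      exact ⟨by omega, fun i hi => Fin.subsingleton_iff_le_one.2 (h3 i hi).le⟩
  have hterm : ∀ k ∈ Fintype.piFinset fun _ : I => Finset.Icc 1 (n + 1),
      treeCoeff (corolla n)
        (PreLie.cls (n + 1) (PreLie.comp (treeOp T) fun i => (y i).lift (k i))) =
      if k = Function.update (fun _ => 1) T.root (n + 1 - Fintype.card I + 1) then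
        if T.IsCorolla then ∏ i, corollaSum (Fin (k i)) ((y i).lift (k i)) else 0 else 0 := by
    intro k hk
    rw [treeCoeff_corolla_cls, corollaSum_comp_treeOp]
    simp only [← hiff k hk, Nat.card_eq_fintype_card, Fintype.card_sigma, Fintype.card_fin]
    split_ifs <;> first | rfl | tauto
  rw [map_sum, Finset.sum_congr rfl hterm, Finset.sum_ite_eq', if_pos]
  · split_ifs with hT
    · rw [← Finset.mul_prod_erase _ _ (Finset.mem_univ T.root)]
      congr 1
      · rw [Function.update_self, corollaSum_lift, coeff_corollaSeries]
      · refine Finset.prod_congr rfl fun i hi => ?_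
        rw [Function.update_of_ne (Finset.ne_of_mem_erase hi), coeff_corollaSeries]
        exact corollaSum_lift _ 0
    · rfl
  · simp only [Fintype.mem_piFinset, Finset.mem_Icc]
    intro i
    by_cases hi : i = T.root
    · subst hi; rw [Function.update_self]; omega
    · rw [Function.update_of_ne hi]; omega

/-- The series of corollas turns the product `×` into the twisted product of series. -/
lemma corollaSeries_mul (x y : PreLie.Completion) :
    corollaSeries (x * y) =
      PowerSeries.rescale (PowerSeries.constantCoeff (corollaSeries y)) (corollaSeries x) *
        corollaSeries y := by
  classical
  ext n
  rw [coeff_corollaSeries, mul_apply, map_sum, PowerSeries.coeff_mul,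
    Finset.Nat.sum_antidiagonal_eq_sum_range_succ_mk]
  rw [Finset.sum_bij' (t := Finset.range (n + 1)) (g := fun a =>
    PowerSeries.coeff a (PowerSeries.rescale (PowerSeries.constantCoeff (corollaSeries y))
      (corollaSeries x)) * PowerSeries.coeff (n - a) (corollaSeries y))
    (fun m _ => m - 1) (fun a _ => a + 1)]
  · intro m hm; simp at hm ⊢; omega
  · intro m hm; simp at hm ⊢; omega
  · intro m hm; simp at hm ⊢; omega
  · intro m hm; simp
  · intro m hm
    rw [Finset.mem_Icc] at hm
    obtain ⟨a, rfl⟩ : ∃ a, m = a + 1 := ⟨m - 1, by omega⟩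
    rw [PowerSeries.coeff_rescale, coeff_corollaSeries x, Nat.add_sub_cancel, ← corollaSum_lift]
    generalize x.lift (a + 1) = w
    refine LinearMap.congr_fun (f := treeCoeff (corolla n) ∘ₗ contrib y (n + 1) (n + 1))
      (g := (PowerSeries.constantCoeff (corollaSeries y) ^ a *
        PowerSeries.coeff (n - a) (corollaSeries y)) • corollaSum (Fin (a + 1)))
      (preLie_linearMap_ext fun T => ?_) w |>.trans ?_
    · rw [LinearMap.comp_apply, contrib_apply, LinearMap.smul_apply, corollaSum_treeOp]
      convert treeCoeff_corolla_sum_comp n (by simpa using hm.2) T fun _ => y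
      simp [mul_comm]
    · rw [LinearMap.smul_apply, smul_eq_mul]; ring

/-! ### Invertible elements of the completion -/

namespace AugOperad

variable {P : AugOperad}

/-- The arity `n` component of the linear map `x ↦ x × y` restricted to arity `m`. -/
noncomputable def mulRight (y : P.Completion) (n m : ℕ) : P.Coinv m →ₗ[ℚ] P.Coinv n :=
  Representation.Coinvariants.lift (P.rep m) (contrib y n n)
    fun σ => LinearMap.ext fun w => contrib_map y n n σ w

lemma mulRight_mk (y : P.Completion) (n m : ℕ) (w : P.obj (Fin m)) :
    mulRight y n m (Representation.Coinvariants.mk (P.rep m) w) = contrib y n n w := by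
  simp [mulRight]

instance : Subsingleton (P.Coinv 0) := by
  refine ⟨fun a b => ?_⟩
  obtain ⟨a, rfl⟩ := Representation.Coinvariants.mk_surjective (P.rep 0) a
  obtain ⟨b, rfl⟩ := Representation.Coinvariants.mk_surjective (P.rep 0) b
  have e : Fin 0 ≃ Empty := Equiv.equivOfIsEmpty _ _
  rw [← cls_fin, ← cls_fin, ← cls_map 0 e, ← cls_map 0 e, P.arity_zero (P.map e a),
    P.arity_zero (P.map e b)]

lemma mul_apply_eq_sum_mulRight (x y : P.Completion) (n : ℕ) :
    (x * y) n = ∑ m ∈ Finset.range (n + 1), mulRight y n m (x m) := by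
  rw [mul_apply_trunc x y n n le_rfl]
  have h : ∀ m, contrib y n n (x.lift m) = mulRight y n m (x m) := fun m => by
    rw [← mulRight_mk, x.mk_lift]
  simp only [h]
  refine Finset.sum_subset (fun m hm => ?_) fun m hm hm' => ?_
  · simp at hm ⊢; omega
  · obtain rfl : m = 0 := by simp at hm hm'; omega
    rw [show x 0 = 0 from Subsingleton.elim (α := P.Coinv 0) _ _, map_zero]

/-- In the top arity, only the arity one part of the right factor matters. -/
lemma mulRight_self (y : P.Completion) (c : ℚ) (hy : y 1 = c • P.cls 1 P.one) (n : ℕ)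
    (a : P.Coinv n) : mulRight y n n a = c ^ n • a := by
  obtain ⟨w, rfl⟩ := Representation.Coinvariants.mk_surjective (P.rep n) a
  rw [mulRight_mk, contrib_apply]
  rcases Nat.eq_zero_or_pos n with rfl | hn
  · exact Subsingleton.elim _ _
  rw [Finset.sum_eq_single fun _ => 1]
  · rw [cls_comp_congr (k := fun _ => 1) (b := fun _ => c • clsRep 1 P.one)]
    · rw [MultilinearMap.map_smul_univ, map_smul]
      have h1 : (fun _ : Fin n => clsRep 1 P.one) =
          fun _ => P.map (Finite.equivFinOfCardEq (by simp : Nat.card Unit = 1)) P.one := by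
        funext j; simp [clsRep]
      rw [h1, P.comp_map_right, cls_map, ← cls_map n (Equiv.sigmaUnique (Fin n) fun _ => Unit),
        P.comp_one, cls_fin]
      simp
    · intro i
      rw [Completion.mk_lift, hy, map_smul, mk_clsRep]
  · intro k hk hne
    refine cls_of_ne ?_ _
    simp only [Fintype.mem_piFinset, Finset.mem_Icc] at hk
    have h2 : ∑ _i : Fin n, 1 < ∑ i, k i := by
      obtain ⟨i, hi⟩ := Function.ne_iff.1 hne
      exact Finset.sum_lt_sum (fun i _ => (hk i).1)
        ⟨i, Finset.mem_univ i, lt_of_le_of_ne (hk i).1 (Ne.symm hi)⟩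
    simp at h2 ⊢
    omega
  · intro h
    exact absurd (by simp; omega) h

/-- The solution `y` of `y × x = 1` when the arity one component of `x` is `c e`, `c ≠ 0`, computed
arity by arity. -/
noncomputable def leftInv (x : P.Completion) (c : ℚ) (n : ℕ) : P.Coinv n :=
  (c ^ n)⁻¹ • ((1 : P.Completion) n - ∑ m : Fin n, mulRight x n m (leftInv x c m))
termination_by n

lemma leftInv_mul (x : P.Completion) {c : ℚ} (hc : c ≠ 0) (hx : x 1 = c • P.cls 1 P.one) :
    (show P.Completion from leftInv x c) * x = 1 := by
  funext n
  rw [mul_apply_eq_sum_mulRight, Finset.sum_range_succ, mulRight_self x c hx,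
    Finset.sum_range fun m => mulRight x n m (leftInv x c m), leftInv,
    smul_inv_smul₀ (pow_ne_zero n hc)]
  exact add_sub_cancel _ _

/-- An element of the completion is invertible as soon as its arity one component is. -/
lemma isUnit_of_apply_one (x : P.Completion) {c : ℚ} (hc : c ≠ 0)
    (hx : x 1 = c • P.cls 1 P.one) : IsUnit x := by
  obtain ⟨y, hy⟩ : ∃ y : P.Completion, y = leftInv x c := ⟨_, rfl⟩
  have hyx : y * x = 1 := by rw [hy]; exact leftInv_mul x hc hx
  have hy1 : y 1 = c⁻¹ • P.cls 1 P.one := by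
    have h0 : leftInv x c (0 : Fin 1) = 0 := Subsingleton.elim (α := P.Coinv 0) _ _
    rw [hy, leftInv, Fin.sum_univ_one, h0]
    simp [one_apply]
  -- `y` has a left inverse as well, which then coincides with `x`
  have hz := leftInv_mul y (inv_ne_zero hc) hy1
  exact ⟨⟨x, y, by rwa [left_inv_eq_right_inv hz hyx] at hz, hyx⟩, rfl⟩

end AugOperad

/-! ### The group of the operad of corollas -/

/-- The coefficient of the corolla in the coinvariants of `Mu(n + 1)`: the sum of the coefficients
of the corollas vanishes on the other trees and is invariant under relabelling. -/
noncomputable def muCoeff (n : ℕ) : Mu.Coinv (n + 1) →ₗ[ℚ] ℚ :=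
  Representation.Coinvariants.lift (Mu.rep (n + 1))
    ((nonCorollas (Fin (n + 1))).liftQ (corollaSumAux (Fin (n + 1))) fun x hx => by
      classical
      rw [LinearMap.mem_ker, corollaSumAux_apply]
      refine Finset.sum_eq_zero fun T _ => ?_
      split_ifs with hT
      · exact (mem_nonCorollas x).1 hx T hT
      · rfl)
    (by
      intro σ
      refine LinearMap.ext fun x => ?_
      obtain ⟨x, rfl⟩ := (nonCorollas (Fin (n + 1))).mkQ_surjective x
      exact corollaSum_map σ x)

lemma muCoeff_coinv (n : ℕ) (a : PreLie.Coinv (n + 1)) :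
    muCoeff n (psi.coinv (n + 1) a) = treeCoeff (corolla n) a := by
  obtain ⟨x, rfl⟩ := Representation.Coinvariants.mk_surjective (PreLie.rep (n + 1)) a
  rw [treeCoeff_corolla_mk]
  rfl

lemma psi_app_treeOp_of_not_isCorolla {I : Type} {T : RTree I} (hT : ¬ T.IsCorolla) :
    psi.app I (treeOp T) = 0 :=
  (Submodule.Quotient.mk_eq_zero (nonCorollas I)).2 (Submodule.subset_span ⟨T, hT, rfl⟩)

/-- All corollas with labelled vertices have the class `νₙ`, and the other trees vanish in `Mu`. -/
lemma psi_coinv_eq (n : ℕ) (a : PreLie.Coinv (n + 1)) :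
    psi.coinv (n + 1) a = treeCoeff (corolla n) a • nu n := by
  classical
  obtain ⟨x, rfl⟩ := Representation.Coinvariants.mk_surjective (PreLie.rep (n + 1)) a
  rw [treeCoeff_corolla_mk]
  refine LinearMap.congr_fun (f := psi.coinv (n + 1) ∘ₗ
    Representation.Coinvariants.mk (PreLie.rep (n + 1)))
    (g := (corollaSum (Fin (n + 1))).smulRight (nu n)) (preLie_linearMap_ext fun T => ?_) x
  rw [LinearMap.comp_apply, Hom.coinv_mk, LinearMap.smulRight_apply, corollaSum_treeOp]
  split_ifs with hT
  · obtain ⟨σ, rfl⟩ := (isCorolla_iff_exists_relabel T).1 hT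
    have h : treeOp ((corolla n).relabel σ) = PreLie.map σ (treeOp (corolla n)) :=
      (relabelLin_single σ (corolla n) 1).symm
    rw [one_smul, nu, ← cls_fin, h, psi.app_map, cls_map]
  · rw [psi_app_treeOp_of_not_isCorolla hT, map_zero, zero_smul]

lemma psi_completion_surjective : Function.Surjective psi.completion := by
  intro u
  have h : ∀ n, ∃ a, psi.coinv n a = u n := by
    intro n
    obtain ⟨x, hx⟩ := Representation.Coinvariants.mk_surjective (Mu.rep n) (u n)
    obtain ⟨y, rfl⟩ := (nonCorollas (Fin n)).mkQ_surjective x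
    exact ⟨Representation.Coinvariants.mk (PreLie.rep n) y, (psi.coinv_mk n y).trans hx⟩
  choose a ha using h
  exact ⟨a, funext ha⟩

/-- The generating series of the coefficients of an element of the completion of `Mu`. -/
noncomputable def muSeries (u : Mu.Completion) : ℚ⟦X⟧ :=
  PowerSeries.mk fun n => muCoeff n (u (n + 1))

lemma muSeries_psi (x : PreLie.Completion) : muSeries (psi.completion x) = corollaSeries x := by
  ext n
  rw [muSeries, corollaSeries, PowerSeries.coeff_mk, PowerSeries.coeff_mk]
  exact muCoeff_coinv n _

lemma muSeries_mul (u v : Mu.Completion) :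
    muSeries (u * v) = PowerSeries.rescale (PowerSeries.constantCoeff (muSeries v)) (muSeries u) *
      muSeries v := by
  obtain ⟨x, rfl⟩ := psi_completion_surjective u
  obtain ⟨y, rfl⟩ := psi_completion_surjective v
  rw [← map_mul, muSeries_psi, muSeries_psi, muSeries_psi, corollaSeries_mul]

lemma apply_succ_eq_smul_nu (u : Mu.Completion) (n : ℕ) :
    u (n + 1) = PowerSeries.coeff n (muSeries u) • nu n := by
  obtain ⟨x, rfl⟩ := psi_completion_surjective u
  rw [muSeries_psi, coeff_corollaSeries]
  exact psi_coinv_eq n _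

lemma muSeries_injective : Function.Injective muSeries := by
  intro u v h
  funext n
  cases n with
  | zero => exact Subsingleton.elim (α := Mu.Coinv 0) _ _
  | succ n => rw [apply_succ_eq_smul_nu u, apply_succ_eq_smul_nu v, h]

lemma muCoeff_nu (n : ℕ) : muCoeff n (nu n) = 1 := by
  classical
  rw [nu, ← psi.coinv_cls, muCoeff_coinv, treeCoeff_corolla_cls, if_pos (by simp),
    corollaSum_treeOp, if_pos (isCorolla_corolla n)]

lemma muSeries_surjective : Function.Surjective muSeries := by
  intro F
  refine ⟨fun n => match n with
    | 0 => 0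
    | n + 1 => PowerSeries.coeff n F • nu n, ?_⟩
  ext n
  exact (PowerSeries.coeff_mk _ _).trans (by simp [muCoeff_nu])

lemma corollaSeries_one : corollaSeries 1 = 1 := by
  classical
  ext n
  rw [coeff_corollaSeries, one_apply, treeCoeff_corolla_cls, PowerSeries.coeff_one,
    show PreLie.one = treeOp dot from rfl, corollaSum_treeOp,
    if_pos (show dot.IsCorolla from fun _ => rfl)]
  simp

lemma muSeries_one : muSeries 1 = 1 := by
  rw [← map_one psi.completion, muSeries_psi, corollaSeries_one]

/-- The series `λ f(x)` of a pair `(λ, f)`. -/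
noncomputable def ScaledSeries.toSeries (s : ScaledSeries) : ℚ⟦X⟧ :=
  PowerSeries.C (s.scale : ℚ) * s.series

namespace ScaledSeries

lemma constantCoeff_toSeries (s : ScaledSeries) :
    PowerSeries.constantCoeff s.toSeries = s.scale := by
  rw [toSeries, map_mul, s.constantCoeff_series, PowerSeries.constantCoeff_C, mul_one]

lemma toSeries_mul (s t : ScaledSeries) :
    (s * t).toSeries =
      PowerSeries.rescale (PowerSeries.constantCoeff t.toSeries) s.toSeries * t.toSeries := by
  rw [constantCoeff_toSeries]
  have h : PowerSeries.rescale (t.scale : ℚ) (PowerSeries.C (s.scale : ℚ)) =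
      PowerSeries.C (s.scale : ℚ) := by
    ext n
    rw [PowerSeries.coeff_rescale, PowerSeries.coeff_C]
    split_ifs with hn <;> simp [hn]
  simp only [toSeries, mul_scale, mul_series, map_mul, h, Units.val_mul]
  ring

lemma toSeries_one : (1 : ScaledSeries).toSeries = 1 := by
  simp [toSeries, one_scale, one_series]

lemma toSeries_injective : Function.Injective toSeries := by
  intro s t h
  have h1 : s.scale = t.scale := by
    ext
    rw [← constantCoeff_toSeries, ← constantCoeff_toSeries, h]
  refine ScaledSeries.ext h1 ?_
  have hC : PowerSeries.C (t.scale : ℚ) ≠ 0 := by simp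
  rw [toSeries, toSeries, h1] at h
  exact mul_left_cancel₀ hC h

lemma exists_toSeries_eq {F : ℚ⟦X⟧} (hF : PowerSeries.constantCoeff F ≠ 0) :
    ∃ s : ScaledSeries, s.toSeries = F := by
  refine ⟨⟨Units.mk0 _ hF, PowerSeries.C (PowerSeries.constantCoeff F)⁻¹ * F, ?_⟩, ?_⟩
  · rw [map_mul, PowerSeries.constantCoeff_C, inv_mul_cancel₀ hF]
  · change PowerSeries.C (PowerSeries.constantCoeff F) *
      (PowerSeries.C (PowerSeries.constantCoeff F)⁻¹ * F) = F
    rw [← mul_assoc, ← map_mul, mul_inv_cancel₀ hF, map_one, one_mul]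

end ScaledSeries

/-- The morphism sending `(λ, ∑ₙ fₙ xⁿ)` to `λ ∑ₙ fₙ νₙ`. -/
noncomputable def scaledSeriesHom : ScaledSeries →* Mu.Completion where
  toFun s := Function.surjInv muSeries_surjective s.toSeries
  map_one' := muSeries_injective <| by
    rw [Function.surjInv_eq muSeries_surjective, muSeries_one, ScaledSeries.toSeries_one]
  map_mul' s t := muSeries_injective <| by
    simp only [muSeries_mul, Function.surjInv_eq muSeries_surjective, ScaledSeries.toSeries_mul]

lemma muSeries_scaledSeriesHom (s : ScaledSeries) :
    muSeries (scaledSeriesHom s) = s.toSeries :=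
  Function.surjInv_eq muSeries_surjective _

lemma constantCoeff_muSeries_ne_zero (u : Mu.Gp) :
    PowerSeries.constantCoeff (muSeries (u : Mu.Completion)) ≠ 0 := by
  intro h
  have h1 := congrArg PowerSeries.constantCoeff (muSeries_mul ((u⁻¹ : Mu.Gp) : Mu.Completion) u)
  rw [Units.inv_mul, muSeries_one, map_mul, h, mul_zero, map_one] at h1
  exact one_ne_zero h1

lemma scaledSeriesHom_toHomUnits_bijective :
    Function.Bijective (scaledSeriesHom.toHomUnits : ScaledSeries →* Mu.Gp) := by
  constructor
  · intro s t h
    have h1 := congrArg (fun u : Mu.Gp => muSeries (u : Mu.Completion)) h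
    simp only [MonoidHom.coe_toHomUnits, muSeries_scaledSeriesHom] at h1
    exact ScaledSeries.toSeries_injective h1
  · intro u
    obtain ⟨s, hs⟩ := ScaledSeries.exists_toSeries_eq (constantCoeff_muSeries_ne_zero u)
    refine ⟨s, Units.ext (muSeries_injective ?_)⟩
    rw [MonoidHom.coe_toHomUnits, muSeries_scaledSeriesHom, hs]

/-- The isomorphism from the group of `Mu` to `ℚˣ ⋉ (1 + xℚ⟦x⟧)`. -/
noncomputable def muGpEquiv : Mu.Gp ≃* ScaledSeries :=
  (MulEquiv.ofBijective _ scaledSeriesHom_toHomUnits_bijective).symm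

lemma toSeries_muGpEquiv (u : Mu.Gp) :
    (muGpEquiv u).toSeries = muSeries (u : Mu.Completion) := by
  obtain ⟨s, rfl⟩ := muGpEquiv.symm.surjective u
  rw [MulEquiv.apply_symm_apply]
  exact (muSeries_scaledSeriesHom s).symm

/-! ### The exponential and its inverse -/

lemma treeCoeff_generator (n : ℕ) :
    treeCoeff (corolla n) (generator (n + 1)) = if n = 0 then 1 else 0 := by
  rw [← coeff_corollaSeries, show generator = 1 from rfl, corollaSeries_one,
    PowerSeries.coeff_one]

/-- Grafting the generator on `a` yields a corolla only if `a` is a corolla, the grafting being at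
its root. -/
lemma treeCoeff_preLieMul_generator (a : PreLie.Completion) (n : ℕ) :
    treeCoeff (corolla (n + 1)) (preLieMul a generator (n + 2)) =
      treeCoeff (corolla n) (a (n + 1)) := by
  have h := treeCoeff_corolla_sum_comp (n + 1) (I := Fin 2) (by simp) (corolla 1)
    ![a, generator]
  have herase : ∀ inst : DecidableEq (Fin 2),
      @Finset.erase _ inst Finset.univ (corolla 1).root = {1} := fun inst => by
    rw [Subsingleton.elim inst (instDecidableEqFin 2)]
    rfl
  rw [if_pos (isCorolla_corolla 1), herase, Finset.prod_singleton] at h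
  rw [← coeff_corollaSeries a]
  refine Eq.trans ?_ (h.trans ?_)
  · unfold preLieMul
    congr!
  · simp [coeff_corollaSeries, treeCoeff_generator]
    rfl

lemma treeCoeff_rightIterate (k n : ℕ) (h : k ≤ n) :
    treeCoeff (corolla n) (rightIterate k (n + 1)) = if n = k then 1 else 0 := by
  induction k generalizing n with
  | zero => exact treeCoeff_generator n
  | succ k ih =>
    obtain ⟨n, rfl⟩ : ∃ m, n = m + 1 := ⟨n - 1, by omega⟩
    rw [rightIterate, treeCoeff_preLieMul_generator, ih n (by omega)]
    simp

lemma treeCoeff_expStar (n : ℕ) :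
    treeCoeff (corolla n) (expStar (n + 1)) = 1 / ((n + 1).factorial : ℚ) := by
  rw [expStar, map_sum, Finset.sum_eq_single n]
  · rw [map_smul, treeCoeff_rightIterate n n le_rfl]; simp
  · intro k hk hne
    rw [map_smul, treeCoeff_rightIterate k n (by simp at hk; omega), if_neg (Ne.symm hne),
      smul_zero]
  · simp

lemma isUnit_expStar : IsUnit expStar :=
  isUnit_of_apply_one expStar one_ne_zero <| by
    simp only [expStar, Finset.sum_range_one, rightIterate]
    simp [generator]
    rfl

lemma corollaSeries_expStar_mul_X :
    corollaSeries expStar * PowerSeries.X = PowerSeries.exp ℚ - 1 := by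
  ext n
  cases n with
  | zero => simp
  | succ n =>
    rw [PowerSeries.coeff_succ_mul_X, coeff_corollaSeries, treeCoeff_expStar]
    simp [PowerSeries.coeff_exp, PowerSeries.coeff_one]

theorem mainTheorem5 :
    ∃ Φ : Mu.Gp ≃* ScaledSeries,
      (∀ (u : Mu.Gp) (n : ℕ), (u : Mu.Completion) (n + 1) =
        (((Φ u).scale : ℚ) * PowerSeries.coeff n (Φ u).series) • nu n) ∧
      ∃ E : PreLie.Gp, (E : PreLie.Completion) = expStar ∧
        ((Φ (psi.gp E)).scale = 1 ∧
          (Φ (psi.gp E)).series * PowerSeries.X = PowerSeries.exp ℚ - 1) ∧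
        ((Φ (psi.gp E⁻¹)).scale = 1 ∧
          (Φ (psi.gp E⁻¹)).series * (PowerSeries.exp ℚ - 1) = PowerSeries.X) ∧
        (∀ n : ℕ, treeCoeff (RTree.corolla n) ((E : PreLie.Completion) (n + 1)) =
          1 / ((n + 1).factorial : ℚ)) ∧
        (∀ n : ℕ, treeCoeff (RTree.corolla n) (((E⁻¹ : PreLie.Gp) : PreLie.Completion) (n + 1)) =
          bernoulli n / (n.factorial : ℚ)) := by
  obtain ⟨E, hE⟩ := isUnit_expStar
  have htoSeries : ∀ x : PreLie.Gp,
      (muGpEquiv (psi.gp x)).toSeries = corollaSeries (x : PreLie.Completion) := fun x => by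
    rw [toSeries_muGpEquiv]
    exact muSeries_psi _
  -- an element whose series of corollas has constant term `1` has scale `1`
  have hscale : ∀ x : PreLie.Gp,
      PowerSeries.constantCoeff (corollaSeries (x : PreLie.Completion)) = 1 →
      (muGpEquiv (psi.gp x)).scale = 1 ∧
        (muGpEquiv (psi.gp x)).series = corollaSeries (x : PreLie.Completion) := by
    intro x hx
    have h1 : (muGpEquiv (psi.gp x)).scale = 1 := by
      ext
      rw [← ScaledSeries.constantCoeff_toSeries, htoSeries, hx, Units.val_one]
    refine ⟨h1, ?_⟩
    rw [← htoSeries, ScaledSeries.toSeries, h1, Units.val_one, map_one, one_mul]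
  have hE0 : PowerSeries.constantCoeff (corollaSeries (E : PreLie.Completion)) = 1 := by
    rw [hE, ← PowerSeries.coeff_zero_eq_constantCoeff_apply, coeff_corollaSeries,
      treeCoeff_expStar]
    simp
  have hmul : corollaSeries ((E⁻¹ : PreLie.Gp) : PreLie.Completion) *
      corollaSeries (E : PreLie.Completion) = 1 := by
    have h := corollaSeries_mul ((E⁻¹ : PreLie.Gp) : PreLie.Completion) E
    rw [Units.inv_mul, corollaSeries_one, hE0, PowerSeries.rescale_one, RingHom.id_apply] at h
    exact h.symm
  have hinv0 : PowerSeries.constantCoeff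
      (corollaSeries ((E⁻¹ : PreLie.Gp) : PreLie.Completion)) = 1 := by
    have h := congrArg PowerSeries.constantCoeff hmul
    rwa [map_mul, hE0, mul_one, map_one] at h
  have hlog : corollaSeries ((E⁻¹ : PreLie.Gp) : PreLie.Completion) * (PowerSeries.exp ℚ - 1) =
      PowerSeries.X := by
    rw [← corollaSeries_expStar_mul_X, ← hE, ← mul_assoc, hmul, one_mul]
  refine ⟨muGpEquiv, fun u n => ?_, E, hE, ?_, ?_, fun n => ?_, fun n => ?_⟩
  · rw [apply_succ_eq_smul_nu u, ← toSeries_muGpEquiv, ScaledSeries.toSeries,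
      PowerSeries.coeff_C_mul]
  · rw [(hscale E hE0).2, hE]
    exact ⟨(hscale E hE0).1, corollaSeries_expStar_mul_X⟩
  · rw [(hscale E⁻¹ hinv0).2]
    exact ⟨(hscale E⁻¹ hinv0).1, hlog⟩
  · rw [hE, treeCoeff_expStar]
  · have hne : PowerSeries.exp ℚ - 1 ≠ 0 := fun h => by
      rw [h, mul_zero] at hlog
      exact PowerSeries.X_ne_zero hlog.symm
    have h : corollaSeries ((E⁻¹ : PreLie.Gp) : PreLie.Completion) = bernoulliPowerSeries ℚ :=
      mul_right_cancel₀ hne (hlog.trans (bernoulliPowerSeries_mul_exp_sub_one ℚ).symm)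
    rw [← coeff_corollaSeries, h, bernoulliPowerSeries, PowerSeries.coeff_mk]
    simp
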